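/- Let $q$ be a complex number with $0<|q|<1$. Write $$(x;q)_n=\prod_{i=0}^{n-1}(1-q^ix),\qquad (x;q)_\infty=\prod_{i\ge 0}(1-q^ix),\qquad (x,y;q)_n=(x;q)_n(y;q)_n,$$ $$j(x;q)=(x;q)_\infty(q/x;q)_\infty(q;q)_\infty,\qquad J_m=\prod_{i\ge1}(1-q^{mi}),\qquad \overline J_{1,4}=j(-q;q^4),$$ and let $$m(x,q,z)=\frac1{j(z;q)}\sum_{r=-\infty}^{\infty}\frac{(-1)^rq^{\binom r2}z^r}{1-q^{r-1}xz}$$ denote the Appell--Lerch sum. **Theorem.** Let $a$ be a nonzero complex number with $a\ne -q^k$ for every integer $k$. Then the series on the left-hand side below converges absolutely, and $$\Big(1+\frac1a\Big)\sum_{n=0}^{\infty}\frac{(aq,q/a;q^2)_n\,q^{2n+1}}{(-q;q)_{2n+1}} =2\,m(a,q^2,-1)-\frac{j(aq;q^2)}{\overline J_{1,4}}\,m(a,q,-1)-\frac12\,\frac{J_1^5}{J_2^4}\,\frac{j(aq;q^2)}{j(-a;q)}.$$ -/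

import Mathlib

/-- The finite `q`-Pochhammer symbol `(x;q)_n = ∏_{i=0}^{n-1} (1 - q^i x)`. -/
noncomputable def qPoch (x q : ℂ) (n : ℕ) : ℂ :=
  ∏ i ∈ Finset.range n, (1 - q ^ i * x)

/-- The infinite `q`-Pochhammer symbol `(x;q)_∞ = ∏_{i ≥ 0} (1 - q^i x)`, for `|q| < 1`. -/
noncomputable def qPochInf (x q : ℂ) : ℂ :=
  ∏' i : ℕ, (1 - q ^ i * x)

/-- The theta function `j(x;q) = (x;q)_∞ (q/x;q)_∞ (q;q)_∞`. -/
noncomputable def thetaJ (x q : ℂ) : ℂ :=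
  qPochInf x q * qPochInf (q / x) q * qPochInf q q

/-- `J_m = ∏_{i ≥ 1} (1 - q^{m i}) = (q^m;q^m)_∞`. -/
noncomputable def eulerJ (m : ℕ) (q : ℂ) : ℂ :=
  qPochInf (q ^ m) (q ^ m)

/-- `J̄_{a,m} = j(-q^a; q^m)`. -/
noncomputable def thetaJBar (a : ℤ) (m : ℕ) (q : ℂ) : ℂ :=
  thetaJ (-q ^ a) (q ^ m)

/-- The `r`-th term `(-1)^r q^{r(r-1)/2} z^r / (1 - q^{r-1} x z)` of the bilateral series in the
definition of `m(x,q,z)`.  The integer division is exact. -/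
noncomputable def appellLerchTerm (x q z : ℂ) (r : ℤ) : ℂ :=
  (-1) ^ r * q ^ (r * (r - 1) / 2) * z ^ r / (1 - q ^ (r - 1) * x * z)

/-- The Appell–Lerch sum
`m(x,q,z) = j(z;q)⁻¹ ∑_{r ∈ ℤ} (-1)^r q^{r(r-1)/2} z^r / (1 - q^{r-1} x z)`. -/
noncomputable def appellLerch (x q z : ℂ) : ℂ :=
  1 / thetaJ z q * ∑' r : ℤ, appellLerchTerm x q z r

/-- The infinite products above converge. -/
theorem qPoch_multipliable {q : ℂ} (hq1 : ‖q‖ < 1) (x : ℂ) :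
    Multipliable fun i : ℕ => 1 - q ^ i * x := by
  have h : Summable fun i : ℕ => ‖-(q ^ i * x)‖ := by
    simp only [norm_neg, norm_mul, norm_pow]
    exact (summable_geometric_of_lt_one (norm_nonneg q) hq1).mul_right _
  simpa [sub_eq_add_neg] using multipliable_one_add_of_summable h

theorem appellLerchTerm_ne_zero {x q z : ℂ} (hq : q ≠ 0) (hz : z ≠ 0)
    (h : ∀ k : ℤ, 1 - q ^ k * x * z ≠ 0) (r : ℤ) : appellLerchTerm x q z r ≠ 0 := by
  unfold appellLerchTerm
  have := h (r - 1)
  have h1 : ((-1 : ℂ)) ^ r ≠ 0 := zpow_ne_zero _ (by norm_num)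
  have h2 := zpow_ne_zero (r * (r - 1) / 2) hq
  have h3 := zpow_ne_zero r hz
  exact div_ne_zero (mul_ne_zero (mul_ne_zero h1 h2) h3) this

theorem appellLerchTerm_succ {x q z : ℂ} (hq : q ≠ 0) (hz : z ≠ 0)
    (h : ∀ k : ℤ, 1 - q ^ k * x * z ≠ 0) (r : ℤ) :
    appellLerchTerm x q z (r + 1) / appellLerchTerm x q z r =
      -(q ^ r * z) * (1 - q ^ (r - 1) * x * z) / (1 - q ^ r * x * z) := by
  have e : (r + 1) * (r + 1 - 1) / 2 = r * (r - 1) / 2 + r := by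
    have : (r + 1) * (r + 1 - 1) = r * (r - 1) + r * 2 := by ring
    rw [this, Int.add_mul_ediv_right _ _ (by norm_num)]
  have h0 := h (r - 1)
  have h4 := h r
  have h1 : ((-1 : ℂ)) ^ r ≠ 0 := zpow_ne_zero _ (by norm_num)
  have h2 := zpow_ne_zero (r * (r - 1) / 2) hq
  have h3 := zpow_ne_zero r hz
  unfold appellLerchTerm
  rw [e, zpow_add₀ hq, zpow_add₀ hz, zpow_add₀ (by norm_num : (-1 : ℂ) ≠ 0),
    add_sub_cancel_right]
  simp only [zpow_one]
  generalize 1 - q ^ (r - 1) * x * z = A at *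
  generalize 1 - q ^ r * x * z = B at *
  field_simp

/-- The bilateral series defining `m(x,q,z)` converges absolutely away from its poles. -/
theorem appellLerchTerm_summable {x q z : ℂ} (hq : q ≠ 0) (hq1 : ‖q‖ < 1) (hx : x ≠ 0)
    (hz : z ≠ 0) (h : ∀ k : ℤ, 1 - q ^ k * x * z ≠ 0) :
    Summable (appellLerchTerm x q z) := by
  have hp : Filter.Tendsto (fun n : ℕ => q ^ n) Filter.atTop (nhds 0) :=
    tendsto_pow_atTop_nhds_zero_of_norm_lt_one hq1
  refine Summable.of_nat_of_neg ?_ ?_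
  · refine summable_of_ratio_test_tendsto_lt_one (l := 0) one_pos
      (Filter.Eventually.of_forall fun n => appellLerchTerm_ne_zero hq hz h n) ?_
    simp_rw [← norm_div]
    rw [← norm_zero (E := ℂ)]
    refine Filter.Tendsto.norm ?_
    have : Filter.Tendsto (fun n : ℕ => -(q ^ n * z) * (1 - q ^ n * (q⁻¹ * x * z)) /
        (1 - q ^ n * (x * z))) Filter.atTop
        (nhds (-(0 * z) * (1 - 0 * (q⁻¹ * x * z)) / (1 - 0 * (x * z)))) := by
      refine Filter.Tendsto.div ?_ (tendsto_const_nhds.sub (hp.mul_const _)) (by simp)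
      exact (hp.mul_const _).neg.mul (tendsto_const_nhds.sub (hp.mul_const _))
    simp only [zero_mul, neg_zero, zero_div] at this
    refine this.congr fun n => ?_
    have := appellLerchTerm_succ hq hz h n
    push_cast
    rw [this, zpow_sub₀ hq, zpow_natCast, zpow_one]
    congr 1 <;> ring
  · refine summable_of_ratio_test_tendsto_lt_one (l := 0) one_pos
      (Filter.Eventually.of_forall fun n => appellLerchTerm_ne_zero hq hz h _) ?_
    simp_rw [← norm_div]
    rw [← norm_zero (E := ℂ)]
    refine Filter.Tendsto.norm ?_
    have : Filter.Tendsto (fun n : ℕ => -(q ^ n * (q * z⁻¹)) * (q ^ n * q - x * z) /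
        (q ^ n * q - q⁻¹ * x * z)) Filter.atTop
        (nhds (-(0 * (q * z⁻¹)) * (0 * q - x * z) / (0 * q - q⁻¹ * x * z))) := by
      refine Filter.Tendsto.div ?_ ((hp.mul_const _).sub_const _) (by simp [hq, hx, hz])
      exact (hp.mul_const _).neg.mul ((hp.mul_const _).sub_const _)
    simp only [zero_mul, neg_zero, zero_div] at this
    refine this.congr fun n => ?_
    have e := appellLerchTerm_succ hq hz h (-((n + 1 : ℕ) : ℤ))
    have e1 : -((n + 1 : ℕ) : ℤ) + 1 = -(n : ℤ) := by push_cast; ring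
    rw [e1] at e
    rw [← inv_div (appellLerchTerm x q z (-(n : ℤ))), e]
    have hA := h (-((n + 1 : ℕ) : ℤ) - 1)
    have hB := h (-((n + 1 : ℕ) : ℤ))
    have hqn := pow_ne_zero n hq
    have k1 : q ^ (-((n + 1 : ℕ) : ℤ)) = (q ^ n)⁻¹ * q⁻¹ := by
      rw [zpow_neg, zpow_natCast, pow_succ, mul_inv]
    have k2 : q ^ (-((n + 1 : ℕ) : ℤ) - 1) = (q ^ n)⁻¹ * q⁻¹ * q⁻¹ := by
      rw [zpow_sub₀ hq, k1, zpow_one, div_eq_mul_inv]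
    rw [k1] at hB ⊢
    rw [k2] at hA ⊢
    generalize q ^ n = Q at *
    have hB' : 1 - Q⁻¹ * q⁻¹ * x * z = Q⁻¹ * q⁻¹ * (Q * q - x * z) := by field_simp
    have hA' : 1 - Q⁻¹ * q⁻¹ * q⁻¹ * x * z = Q⁻¹ * q⁻¹ * (Q * q - q⁻¹ * x * z) := by field_simp
    rw [hA'] at hA ⊢
    rw [hB'] at hB ⊢
    have hA2 := right_ne_zero_of_mul hA
    have hB2 := right_ne_zero_of_mul hB
    generalize Q * q - x * z = B at *
    generalize Q * q - q⁻¹ * x * z = A at *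
    field_simp

open Filter Topology

/-! Both sides are studied as functions of a on ℂ∖{0}. Write F for the left side and G for the
right. Each satisfies f(q²a) + a f(a) = 2 - (1 - 1/(aq)) j(aq;q²)/J̄_{1,4}. For F the partial sums
of this combination telescope (`sum_eulerianTerm_telescope`); for G it follows from m(qa,q,-1) = 1 -
a m(a,q,-1) and the quasi-periodicity of j (`appellLerchSide_quasiperiodic`). So D = F - G solves
D(q²a) = -a D(a).

F is holomorphic on ℂ∖{0}, and G has at most simple poles, at the points -q^k. The equation for D
relates the residues at -q^k and -q^(k+2), so only -1 and -q need inspection; there the residues of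
G cancel by identities between J_1, J_2 and J_4. Hence D extends holomorphically to ℂ∖{0}. The
equation bounds D by its maximum on the annulus |q|² ≤ |a| ≤ 1, so Liouville's theorem for D(exp z)
makes D a constant c, and a = 1 gives c = -c (`eq_zero_of_quasiperiodic`).

The residues of m(a,q,-1) are read off from the partial fractions j(-1;q)⁻¹ ∑ q^(s(s+1)/2)/(a +
q^s). The functional equation of this sum needs ∑ q^(s(s+1)/2) = j(-1;q), which is Gauss's theorem
on triangular numbers, obtained as the limit of Shanks's finite identity. -/

/-! ### Infinite products, theta functions and their product identities -/

theorem qPoch_tendsto {q : ℂ} (hq1 : ‖q‖ < 1) (x : ℂ) :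
    Tendsto (qPoch x q) atTop (𝓝 (qPochInf x q)) :=
  (qPoch_multipliable hq1 x).hasProd.tendsto_prod_nat

theorem qPoch_succ (x q : ℂ) (n : ℕ) : qPoch x q (n + 1) = qPoch x q n * (1 - q ^ n * x) :=
  Finset.prod_range_succ _ _

theorem qPoch_succ' (x q : ℂ) (n : ℕ) : qPoch x q (n + 1) = (1 - x) * qPoch (q * x) q n := by
  unfold qPoch
  rw [Finset.prod_range_succ', mul_comm]
  congr 1
  · simp
  · exact Finset.prod_congr rfl fun i _ => by ring

theorem norm_sq_lt_one {q : ℂ} (hq1 : ‖q‖ < 1) : ‖q ^ 2‖ < 1 := by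
  rw [norm_pow]; exact pow_lt_one₀ (norm_nonneg q) hq1 two_ne_zero

theorem qPochInf_eq_mul {q : ℂ} (hq1 : ‖q‖ < 1) (x : ℂ) :
    qPochInf x q = (1 - x) * qPochInf (q * x) q := by
  refine tendsto_nhds_unique ((qPoch_tendsto hq1 x).comp (tendsto_add_atTop_nat 1)) ?_
  refine ((qPoch_tendsto hq1 (q * x)).const_mul (1 - x)).congr fun n => ?_
  exact (qPoch_succ' x q n).symm

theorem qPoch_two_mul (x q : ℂ) (n : ℕ) :
    qPoch x q (2 * n) = qPoch x (q ^ 2) n * qPoch (q * x) (q ^ 2) n := by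
  induction n with
  | zero => simp [qPoch]
  | succ n ih =>
    rw [show 2 * (n + 1) = 2 * n + 1 + 1 by ring, qPoch_succ, qPoch_succ, ih, qPoch_succ, qPoch_succ]
    ring

theorem qPochInf_eq_even_mul_odd {q : ℂ} (hq1 : ‖q‖ < 1) (x : ℂ) :
    qPochInf x q = qPochInf x (q ^ 2) * qPochInf (q * x) (q ^ 2) := by
  have h2 : Tendsto (fun n : ℕ => 2 * n) atTop atTop :=
    tendsto_id.const_mul_atTop' two_pos
  refine tendsto_nhds_unique ((qPoch_tendsto hq1 x).comp h2) ?_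
  refine ((qPoch_tendsto (norm_sq_lt_one hq1) x).mul
    (qPoch_tendsto (norm_sq_lt_one hq1) (q * x))).congr fun n => ?_
  exact (qPoch_two_mul x q n).symm

theorem qPochInf_mul_neg {q : ℂ} (hq1 : ‖q‖ < 1) (x : ℂ) :
    qPochInf x q * qPochInf (-x) q = qPochInf (x ^ 2) (q ^ 2) := by
  refine tendsto_nhds_unique ((qPoch_tendsto hq1 x).mul (qPoch_tendsto hq1 (-x))) ?_
  refine (qPoch_tendsto (norm_sq_lt_one hq1) (x ^ 2)).congr fun n => ?_
  unfold qPoch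
  rw [← Finset.prod_mul_distrib]
  exact Finset.prod_congr rfl fun i _ => by ring

theorem qPochInf_ne_zero {q x : ℂ} (hq1 : ‖q‖ < 1) (h : ∀ i : ℕ, q ^ i * x ≠ 1) :
    qPochInf x q ≠ 0 := by
  have hs : Summable fun i : ℕ => ‖-(q ^ i * x)‖ := by
    simp only [norm_neg, norm_mul, norm_pow]
    exact (summable_geometric_of_lt_one (norm_nonneg q) hq1).mul_right _
  have := tprod_one_add_ne_zero_of_summable (f := fun i : ℕ => -(q ^ i * x))
    (fun i => by simpa [← sub_eq_add_neg, sub_eq_zero] using (h i).symm) hs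
  simpa [qPochInf, sub_eq_add_neg] using this

theorem pow_mul_ne_one_of_norm_lt {q x : ℂ} (hq1 : ‖q‖ < 1) (hx : ‖x‖ < 1) (i : ℕ) :
    q ^ i * x ≠ 1 := by
  intro h
  have h1 := congrArg norm h
  rw [norm_mul, norm_pow, norm_one] at h1
  have := mul_le_of_le_one_left (norm_nonneg x) (pow_le_one₀ (n := i) (norm_nonneg q) hq1.le)
  linarith

theorem qPochInf_ne_zero_of_norm_lt {q x : ℂ} (hq1 : ‖q‖ < 1) (hx : ‖x‖ < 1) :
    qPochInf x q ≠ 0 :=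
  qPochInf_ne_zero hq1 (pow_mul_ne_one_of_norm_lt hq1 hx)

/-- Follows from 1 + t ≤ e^t and the geometric series. The bound does not depend on n, which later
gives a majorant for the series uniform in a. -/
theorem norm_qPoch_le {q : ℂ} (hq1 : ‖q‖ < 1) (x : ℂ) (n : ℕ) :
    ‖qPoch x q n‖ ≤ Real.exp (‖x‖ / (1 - ‖q‖)) := by
  unfold qPoch
  rw [norm_prod]
  calc ∏ i ∈ Finset.range n, ‖1 - q ^ i * x‖
      ≤ ∏ i ∈ Finset.range n, Real.exp (‖q‖ ^ i * ‖x‖) := by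
        refine Finset.prod_le_prod (fun _ _ => norm_nonneg _) fun i _ => ?_
        refine (norm_sub_le _ _).trans ?_
        rw [norm_one, norm_mul, norm_pow, add_comm]
        exact Real.add_one_le_exp _
    _ = Real.exp ((∑ i ∈ Finset.range n, ‖q‖ ^ i) * ‖x‖) := by
        rw [← Real.exp_sum, Finset.sum_mul]
    _ ≤ _ := by
        refine Real.exp_le_exp.mpr ?_
        rw [div_eq_inv_mul]
        refine mul_le_mul_of_nonneg_right ?_ (norm_nonneg x)
        rw [← tsum_geometric_of_lt_one (norm_nonneg q) hq1]
        exact (summable_geometric_of_lt_one (norm_nonneg q) hq1).sum_le_tsum _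
          fun _ _ => pow_nonneg (norm_nonneg q) _

theorem differentiable_qPoch (q : ℂ) (n : ℕ) : Differentiable ℂ fun x => qPoch x q n := by
  unfold qPoch
  fun_prop

theorem differentiable_qPochInf {q : ℂ} (hq1 : ‖q‖ < 1) :
    Differentiable ℂ fun x => qPochInf x q := by
  intro x₀
  have hU : IsOpen (Metric.ball (0 : ℂ) (‖x₀‖ + 1)) := Metric.isOpen_ball
  have hu : Summable fun i : ℕ => ‖q‖ ^ i * (‖x₀‖ + 1) :=
    (summable_geometric_of_lt_one (norm_nonneg q) hq1).mul_right _
  have H := hu.hasProdLocallyUniformlyOn_nat_one_add (f := fun i (x : ℂ) => -(q ^ i * x)) hU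
    (Eventually.of_forall fun i x hx => by
      rw [norm_neg, norm_mul, norm_pow]
      have : ‖x‖ < ‖x₀‖ + 1 := by simpa using hx
      gcongr) (fun i => by fun_prop)
  have := H.differentiableOn (Eventually.of_forall fun s => by fun_prop) hU
  have h2 := this.differentiableAt (hU.mem_nhds (by simp : x₀ ∈ _))
  simpa only [qPochInf, sub_eq_add_neg] using h2

theorem differentiableAt_thetaJ {q x : ℂ} (hq1 : ‖q‖ < 1) (hx : x ≠ 0) :
    DifferentiableAt ℂ (fun x => thetaJ x q) x := by
  unfold thetaJ
  have h := differentiable_qPochInf hq1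
  have h2 : DifferentiableAt ℂ (fun x => qPochInf (q / x) q) x :=
    DifferentiableAt.comp (g := fun x => qPochInf x q) x (h _)
      ((differentiableAt_const q).div differentiableAt_id hx)
  exact ((h x).mul h2).mul_const _

/-- The shift x ↦ qx removes the factor 1 - x from one product and adds 1 - x⁻¹ to the other. -/
theorem thetaJ_mul {q x : ℂ} (hq : q ≠ 0) (hq1 : ‖q‖ < 1) (hx : x ≠ 0) :
    thetaJ (q * x) q = -x⁻¹ * thetaJ x q := by
  unfold thetaJ
  rw [show q / (q * x) = x⁻¹ by field_simp, qPochInf_eq_mul hq1 x, qPochInf_eq_mul hq1 x⁻¹,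
    ← div_eq_mul_inv]
  field_simp
  ring

theorem thetaJ_ne_zero {q x : ℂ} (hq : q ≠ 0) (hq1 : ‖q‖ < 1) (hx : x ≠ 0)
    (h : ∀ k : ℤ, x ≠ q ^ k) : thetaJ x q ≠ 0 := by
  unfold thetaJ
  refine mul_ne_zero (mul_ne_zero (qPochInf_ne_zero hq1 fun i hi => h (-i) ?_)
    (qPochInf_ne_zero hq1 fun i hi => h (i + 1) ?_)) (qPochInf_ne_zero_of_norm_lt hq1 hq1)
  · rw [zpow_neg, zpow_natCast]
    exact eq_inv_of_mul_eq_one_right hi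
  · rw [zpow_add_one₀ hq, zpow_natCast]
    field_simp at hi
    exact hi.symm

theorem eulerJ_ne_zero {q : ℂ} (hq1 : ‖q‖ < 1) {m : ℕ} (hm : m ≠ 0) : eulerJ m q ≠ 0 := by
  have : ‖q ^ m‖ < 1 := by rw [norm_pow]; exact pow_lt_one₀ (norm_nonneg q) hq1 hm
  exact qPochInf_ne_zero_of_norm_lt this this

theorem qPochInf_neg_self_mul_eulerJ {q : ℂ} (hq1 : ‖q‖ < 1) :
    qPochInf (-q) q * eulerJ 1 q = eulerJ 2 q := by
  rw [eulerJ, eulerJ, pow_one, mul_comm, qPochInf_mul_neg hq1]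

theorem eulerJ_four_eq (q : ℂ) : eulerJ 4 q = eulerJ 2 (q ^ 2) := by
  rw [eulerJ, eulerJ, ← pow_mul]

theorem eulerJ_two_eq (q : ℂ) : eulerJ 2 q = eulerJ 1 (q ^ 2) := by
  rw [eulerJ, eulerJ, pow_one]

theorem thetaJ_neg_one_mul {q : ℂ} (hq1 : ‖q‖ < 1) :
    thetaJ (-1) q * eulerJ 1 q = 2 * eulerJ 2 q ^ 2 := by
  have h := qPochInf_neg_self_mul_eulerJ hq1
  rw [thetaJ, qPochInf_eq_mul hq1 (-1), show q / -1 = -q by simp [div_neg], mul_neg_one, ← h,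
    show qPochInf q q = eulerJ 1 q by simp [eulerJ]]
  ring

/-- Splitting (-q;q)_∞ into even and odd factors gives (-q;q²)_∞ (-q²;q²)_∞, while (-q;q)_∞ =
J_2/J_1 and (-q²;q²)_∞ = J_4/J_2. -/
theorem qPochInf_neg_self_sq_mul {q : ℂ} (hq1 : ‖q‖ < 1) :
    qPochInf (-q) (q ^ 2) * (eulerJ 1 q * eulerJ 4 q) = eulerJ 2 q ^ 2 := by
  have h := qPochInf_neg_self_mul_eulerJ hq1
  have h2 := qPochInf_neg_self_mul_eulerJ (norm_sq_lt_one hq1)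
  rw [← eulerJ_four_eq, ← eulerJ_two_eq] at h2
  rw [qPochInf_eq_even_mul_odd hq1, mul_neg, ← sq] at h
  linear_combination eulerJ 2 q * h - qPochInf (-q) (q ^ 2) * eulerJ 1 q * h2

theorem thetaJ_neg_self_sq_mul {q : ℂ} (hq : q ≠ 0) (hq1 : ‖q‖ < 1) :
    thetaJ (-q) (q ^ 2) * (eulerJ 1 q * eulerJ 4 q) ^ 2 = eulerJ 2 q ^ 5 := by
  have h := qPochInf_neg_self_sq_mul hq1
  rw [thetaJ, show q ^ 2 / -q = -q by field_simp, show qPochInf (q ^ 2) (q ^ 2) = eulerJ 2 q from rfl]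
  linear_combination (eulerJ 2 q * (qPochInf (-q) (q ^ 2) * (eulerJ 1 q * eulerJ 4 q)
    + eulerJ 2 q ^ 2)) * h

theorem thetaJBar_mul {q : ℂ} (hq : q ≠ 0) (hq1 : ‖q‖ < 1) :
    thetaJBar 1 4 q * eulerJ 1 q = eulerJ 2 q ^ 2 := by
  have h := qPochInf_neg_self_sq_mul hq1
  rw [qPochInf_eq_even_mul_odd (norm_sq_lt_one hq1), ← pow_mul] at h
  rw [thetaJBar, thetaJ, zpow_one, show q ^ 4 / -q = q ^ 2 * -q by field_simp,
    show qPochInf (q ^ 4) (q ^ 4) = eulerJ 4 q from rfl]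
  linear_combination h

/-! ### Gauss's triangular number identity -/

/-- The partial products `∏_{k=1}^n (1 - q^{2k}) / (1 - q^{2k-1})`. -/
noncomputable def gaussProd (q : ℂ) (n : ℕ) : ℂ :=
  qPoch (q ^ 2) (q ^ 2) n / qPoch q (q ^ 2) n

theorem one_sub_pow_ne_zero {q : ℂ} (hq1 : ‖q‖ < 1) {n : ℕ} (hn : n ≠ 0) : 1 - q ^ n ≠ 0 := by
  intro h
  have h1 := congrArg norm (sub_eq_zero.mp h)
  rw [norm_one, norm_pow] at h1
  exact (pow_lt_one₀ (norm_nonneg q) hq1 hn).ne h1.symm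

theorem qPoch_ne_zero_of_norm_lt {q x : ℂ} (hq1 : ‖q‖ < 1) (hx : ‖x‖ < 1) (n : ℕ) :
    qPoch x q n ≠ 0 :=
  Finset.prod_ne_zero_iff.mpr fun i _ =>
    sub_ne_zero.mpr (pow_mul_ne_one_of_norm_lt hq1 hx i).symm

theorem gaussProd_ne_zero {q : ℂ} (hq1 : ‖q‖ < 1) (n : ℕ) : gaussProd q n ≠ 0 :=
  div_ne_zero (qPoch_ne_zero_of_norm_lt (norm_sq_lt_one hq1) (norm_sq_lt_one hq1) n)
    (qPoch_ne_zero_of_norm_lt (norm_sq_lt_one hq1) hq1 n)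

theorem gaussProd_succ {q : ℂ} (n : ℕ) :
    gaussProd q (n + 1) = gaussProd q n * ((1 - q ^ (2 * n + 2)) / (1 - q ^ (2 * n + 1))) := by
  unfold gaussProd
  rw [qPoch_succ, qPoch_succ, mul_div_mul_comm]
  ring_nf

theorem gaussProd_tendsto {q : ℂ} (hq1 : ‖q‖ < 1) :
    Tendsto (gaussProd q) atTop (𝓝 (qPochInf (q ^ 2) (q ^ 2) / qPochInf q (q ^ 2))) :=
  (qPoch_tendsto (norm_sq_lt_one hq1) _).div (qPoch_tendsto (norm_sq_lt_one hq1) _)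
    (qPochInf_ne_zero_of_norm_lt (norm_sq_lt_one hq1) hq1)

/-- This is the change of the first m terms of Shanks's sum when n becomes n + 1. At m = n + 1 the
right side collapses to the single power q^((n+1)(2n+1)). -/
theorem shanks_telescope {q : ℂ} (hq1 : ‖q‖ < 1) (n m : ℕ) :
    ∑ s ∈ Finset.range m, (gaussProd q (n + 1) / gaussProd q s * q ^ (s * (2 * n + 3))
      - gaussProd q n / gaussProd q s * q ^ (s * (2 * n + 1))) =
    gaussProd q n / gaussProd q m * (1 - q ^ (2 * m)) * q ^ (m * (2 * n + 1))
      / (1 - q ^ (2 * n + 1)) := by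
  induction m with
  | zero => simp
  | succ m ih =>
    rw [Finset.sum_range_succ, ih, gaussProd_succ, gaussProd_succ]
    have h1 := gaussProd_ne_zero hq1 m
    have h2 := one_sub_pow_ne_zero hq1 (n := 2 * n + 1) (by omega)
    have h3 := one_sub_pow_ne_zero hq1 (n := 2 * m + 1) (by omega)
    have h4 := one_sub_pow_ne_zero hq1 (n := 2 * m + 2) (by omega)
    rw [show 2 * (m + 1) = 2 * m + 2 by ring]
    field_simp
    ring

/-- Shanks' finite form of Gauss's identity for triangular numbers. -/
theorem shanks_identity {q : ℂ} (hq1 : ‖q‖ < 1) (n : ℕ) :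
    ∑ s ∈ Finset.range (n + 1), gaussProd q n / gaussProd q s * q ^ (s * (2 * n + 1)) =
      ∑ i ∈ Finset.range (2 * n + 1), q ^ (i * (i + 1) / 2) := by
  induction n with
  | zero => simp [gaussProd, qPoch]
  | succ n ih =>
    have h := shanks_telescope hq1 n (n + 1)
    rw [Finset.sum_sub_distrib, ih, sub_eq_iff_eq_add] at h
    rw [Finset.sum_range_succ, show 2 * (n + 1) + 1 = 2 * n + 1 + 1 + 1 by ring,
      Finset.sum_range_succ _ (2 * n + 1 + 1), Finset.sum_range_succ _ (2 * n + 1),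
      show 2 * n + 1 + 1 + 1 = 2 * n + 3 by ring, h]
    -- The two new triangular exponents, i = 2n+1 and i = 2n+2, come from the telescoped difference
    -- and from the new term s = n + 1 respectively.
    have e1 : (2 * n + 1) * (2 * n + 1 + 1) / 2 = (n + 1) * (2 * n + 1) := by
      rw [show (2 * n + 1) * (2 * n + 1 + 1) = (n + 1) * (2 * n + 1) * 2 by ring]; omega
    have e2 : (2 * n + 1 + 1) * (2 * n + 1 + 1 + 1) / 2 = (n + 1) * (2 * n + 3) := by
      rw [show (2 * n + 1 + 1) * (2 * n + 1 + 1 + 1) = (n + 1) * (2 * n + 3) * 2 by ring]; omega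
    rw [e1, e2, gaussProd_succ]
    have h1 := gaussProd_ne_zero hq1 n
    have h2 := one_sub_pow_ne_zero hq1 (n := 2 * n + 1) (by omega)
    have h4 := one_sub_pow_ne_zero hq1 (n := 2 * n + 2) (by omega)
    rw [show 2 * (n + 1) = 2 * n + 2 by ring]
    field_simp
    ring

theorem exists_norm_le_of_tendsto {u : ℕ → ℂ} {l : ℂ} (h : Tendsto u atTop (𝓝 l)) :
    ∃ B : ℝ, 0 ≤ B ∧ ∀ n, ‖u n‖ ≤ B := by
  obtain ⟨B, hB⟩ := h.norm.bddAbove_range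
  exact ⟨B, (norm_nonneg _).trans (hB ⟨0, rfl⟩), fun n => hB ⟨n, rfl⟩⟩

theorem summable_pow_triangular {q : ℂ} (hq1 : ‖q‖ < 1) :
    Summable fun i : ℕ => ‖q ^ (i * (i + 1) / 2)‖ := by
  refine Summable.of_nonneg_of_le (fun _ => norm_nonneg _) (fun i => ?_)
    (summable_geometric_of_lt_one (norm_nonneg q) hq1)
  rw [norm_pow]
  refine pow_le_pow_of_le_one (norm_nonneg q) hq1.le ?_
  rw [Nat.le_div_iff_mul_le two_pos]
  rcases i with _ | i
  · simp
  · gcongr; omega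

theorem tsum_pow_triangular {q : ℂ} (hq1 : ‖q‖ < 1) :
    ∑' i : ℕ, q ^ (i * (i + 1) / 2) = qPochInf (q ^ 2) (q ^ 2) / qPochInf q (q ^ 2) := by
  have hn : Tendsto (fun n : ℕ => 2 * n + 1) atTop atTop :=
    tendsto_atTop_mono (fun n => by simp only [id]; omega) tendsto_id
  refine tendsto_nhds_unique
    ((summable_pow_triangular hq1).of_norm.hasSum.tendsto_sum_nat.comp hn) ?_
  have hP := gaussProd_tendsto hq1
  obtain ⟨B, hB0, hB⟩ := exists_norm_le_of_tendsto hP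
  obtain ⟨C, hC0, hC⟩ := exists_norm_le_of_tendsto (hP.inv₀ (div_ne_zero
    (qPochInf_ne_zero_of_norm_lt (norm_sq_lt_one hq1) (norm_sq_lt_one hq1))
    (qPochInf_ne_zero_of_norm_lt (norm_sq_lt_one hq1) hq1)))
  -- In the limit only the term s = 0 of Shanks's sum survives: the n others are each at most
  -- BC|q|^n.
  have key : Tendsto (fun n : ℕ => ∑ s ∈ Finset.range n,
      gaussProd q n / gaussProd q (s + 1) * q ^ ((s + 1) * (2 * n + 1))) atTop (𝓝 0) := by
    refine squeeze_zero_norm (a := fun n : ℕ => B * C * (n * ‖q‖ ^ n)) (fun n => ?_) ?_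
    · refine (norm_sum_le_of_le (f := fun s : ℕ => gaussProd q n / gaussProd q (s + 1) *
        q ^ ((s + 1) * (2 * n + 1))) _ (n := fun _ => B * C * ‖q‖ ^ n) fun s _ => ?_).trans ?_
      · rw [norm_mul, div_eq_mul_inv, norm_mul, norm_pow]
        refine mul_le_mul (mul_le_mul (hB n) (hC (s + 1)) (norm_nonneg _) hB0) ?_ (by positivity)
          (by positivity)
        exact pow_le_pow_of_le_one (norm_nonneg q) hq1.le (by nlinarith)
      · simp only [Finset.sum_const, Finset.card_range, nsmul_eq_mul]
        exact le_of_eq (by ring)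
    · simpa using (tendsto_self_mul_const_pow_of_lt_one (norm_nonneg q) hq1).const_mul (B * C)
  have := key.add hP
  rw [zero_add] at this
  refine this.congr fun n => ?_
  rw [Function.comp_apply, ← shanks_identity hq1 n, Finset.sum_range_succ']
  simp [gaussProd, qPoch]

/-- The weights `q^{s(s+1)/2}`, `s ∈ ℤ`. -/
noncomputable def triWeight (q : ℂ) (s : ℤ) : ℂ := q ^ (s * (s + 1) / 2)

theorem triWeight_natCast (q : ℂ) (n : ℕ) : triWeight q n = q ^ (n * (n + 1) / 2) := by
  rw [triWeight, ← zpow_natCast]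
  norm_cast

theorem triWeight_neg_add_one (q : ℂ) (n : ℕ) :
    triWeight q (-(n + 1 : ℤ)) = q ^ (n * (n + 1) / 2) := by
  rw [← triWeight_natCast, triWeight, triWeight]
  congr 2
  ring

theorem summable_triWeight {q : ℂ} (hq1 : ‖q‖ < 1) : Summable fun s => ‖triWeight q s‖ := by
  refine Summable.of_nat_of_neg_add_one ?_ ?_
  · simpa only [triWeight_natCast] using summable_pow_triangular hq1
  · simpa only [triWeight_neg_add_one] using summable_pow_triangular hq1

/-- The weights are symmetric under s ↦ -1 - s, so the bilateral sum is twice Gauss's sum J_2²/J_1.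
-/
theorem tsum_triWeight {q : ℂ} (hq1 : ‖q‖ < 1) : ∑' s, triWeight q s = thetaJ (-1) q := by
  have hs := (summable_pow_triangular hq1).of_norm
  rw [tsum_of_nat_of_neg_add_one (by simpa only [triWeight_natCast] using hs)
    (by simpa only [triWeight_neg_add_one] using hs)]
  simp only [triWeight_natCast, triWeight_neg_add_one]
  rw [tsum_pow_triangular hq1]
  have h1 := thetaJ_neg_one_mul hq1
  have h2 := qPochInf_eq_even_mul_odd hq1 q
  have h3 : eulerJ 1 q ≠ 0 := eulerJ_ne_zero hq1 one_ne_zero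
  rw [show qPochInf q q = eulerJ 1 q by simp [eulerJ], ← sq,
    show qPochInf (q ^ 2) (q ^ 2) = eulerJ 2 q from rfl] at h2
  rw [show qPochInf (q ^ 2) (q ^ 2) = eulerJ 2 q from rfl]
  have h4 : qPochInf q (q ^ 2) ≠ 0 := qPochInf_ne_zero_of_norm_lt (norm_sq_lt_one hq1) hq1
  apply mul_right_cancel₀ h3
  rw [h1, h2]
  field_simp
  ring

/-! ### Quasi-periodic functions on the punctured plane -/

/-- The distance from a nonzero point to the points of `{-q^k}` different from it is positive. -/
theorem exists_pos_le_norm_add_zpow {q a : ℂ} (hq : q ≠ 0) (hq1 : ‖q‖ < 1) (ha : a ≠ 0) :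
    ∃ d : ℝ, 0 < d ∧ ∀ k : ℤ, a + q ^ k ≠ 0 → d ≤ ‖a + q ^ k‖ := by
  have hna : 0 < ‖a‖ := norm_pos_iff.mpr ha
  have hnq : 0 < ‖q‖ := norm_pos_iff.mpr hq
  -- For k > N one has |q^k| < |a|/2, and for k < -M one has |q^k| > 2|a|; both give |a + q^k| ≥
  -- |a|/2, leaving finitely many k.
  obtain ⟨N, hN⟩ := exists_pow_lt_of_lt_one (half_pos hna) hq1
  obtain ⟨M, hM⟩ := exists_pow_lt_of_lt_one (inv_pos.mpr (mul_pos two_pos hna)) hq1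
  have hfin : ∀ F : Finset ℤ, ∃ d : ℝ, 0 < d ∧ ∀ k ∈ F, a + q ^ k ≠ 0 → d ≤ ‖a + q ^ k‖ := by
    intro F
    induction F using Finset.induction with
    | empty => exact ⟨1, one_pos, by simp⟩
    | insert k F _ ih =>
      obtain ⟨d, hd, h⟩ := ih
      by_cases hk : a + q ^ k = 0
      · refine ⟨d, hd, fun l hl hl0 => ?_⟩
        rcases Finset.mem_insert.mp hl with rfl | hl
        · exact absurd hk hl0
        · exact h l hl hl0
      · refine ⟨min d ‖a + q ^ k‖, lt_min hd (norm_pos_iff.mpr hk), fun l hl hl0 => ?_⟩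
        rcases Finset.mem_insert.mp hl with rfl | hl
        · exact min_le_right _ _
        · exact (min_le_left _ _).trans (h l hl hl0)
  obtain ⟨d, hd, h⟩ := hfin (Finset.Icc (-(M : ℤ)) N)
  refine ⟨min d (‖a‖ / 2), lt_min hd (half_pos hna), fun k hk => ?_⟩
  by_cases hkF : k ∈ Finset.Icc (-(M : ℤ)) N
  · exact (min_le_left _ _).trans (h k hkF hk)
  refine (min_le_right _ _).trans ?_
  rw [Finset.mem_Icc, not_and_or, not_le, not_le] at hkF
  rcases hkF with hk' | hk'
  · have h1 : ‖q‖ ^ (-(M : ℤ)) ≤ ‖q‖ ^ k := zpow_le_zpow_right_of_le_one₀ hnq hq1.le hk'.le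
    rw [zpow_neg, zpow_natCast] at h1
    have h2 : 2 * ‖a‖ < (‖q‖ ^ M)⁻¹ := by
      rw [lt_inv_comm₀ (by positivity) (by positivity)]; exact hM
    have h3 := norm_sub_le (a + q ^ k) a
    rw [add_sub_cancel_left, norm_zpow] at h3
    linarith
  · have h1 : ‖q‖ ^ k ≤ ‖q‖ ^ (N : ℤ) := zpow_le_zpow_right_of_le_one₀ hnq hq1.le hk'.le
    rw [zpow_natCast] at h1
    have h3 := norm_sub_le (a + q ^ k) (q ^ k)
    rw [add_sub_cancel_right, norm_zpow] at h3
    linarith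

/-- A holomorphic function on `ℂ \ {0}` with `f (p a) = -a f a` vanishes. -/
theorem eq_zero_of_quasiperiodic {p : ℂ} (hp : p ≠ 0) (hp1 : ‖p‖ < 1) {f : ℂ → ℂ}
    (hf : ∀ a ≠ 0, DifferentiableAt ℂ f a) (h : ∀ a ≠ 0, f (p * a) = -a * f a) {a : ℂ}
    (ha : a ≠ 0) : f a = 0 := by
  have hnp : 0 < ‖p‖ := norm_pos_iff.mpr hp
  have hK : IsCompact (Metric.closedBall (0 : ℂ) 1 \ Metric.ball 0 ‖p‖) :=
    (isCompact_closedBall 0 1).diff Metric.isOpen_ball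
  have hc : ContinuousOn f (Metric.closedBall (0 : ℂ) 1 \ Metric.ball 0 ‖p‖) := by
    intro z hz
    refine (hf z ?_).continuousAt.continuousWithinAt
    rintro rfl
    exact hz.2 (by simpa using hp)
  obtain ⟨C, hC⟩ := hK.exists_bound_of_continuousOn hc
  -- The bound spreads from the annulus |p| ≤ |z| ≤ 1 both ways: |f(z)| = |z/p| |f(z/p)| ≤ |f(z/p)|
  -- when |z| < |p|, and |f(z)| ≤ |z| |f(z)| = |f(pz)| when |z| > 1.
  have hC' : ∀ (n : ℕ) (z : ℂ), ‖p‖ ^ (n + 1) ≤ ‖z‖ → ‖z‖ * ‖p‖ ^ n ≤ 1 → ‖f z‖ ≤ C := by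
    intro n
    induction n with
    | zero => exact fun z h1 h2 => hC z (by simpa using ⟨by simpa using h2, by simpa using h1⟩)
    | succ n ih =>
      intro z h1 h2
      have hz : z ≠ 0 := norm_pos_iff.mp (lt_of_lt_of_le (by positivity) h1)
      rcases lt_or_ge ‖z‖ ‖p‖ with hzp | hzp
      · have hb : z / p ≠ 0 := div_ne_zero hz hp
        have hb1 : ‖z / p‖ ≤ 1 := by rw [norm_div, div_le_one hnp]; exact hzp.le
        have e := h (z / p) hb
        rw [mul_div_cancel₀ z hp] at e
        rw [e, norm_mul, norm_neg]
        have := ih (z / p) (by rw [norm_div, le_div_iff₀ hnp]; exact h1)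
          (mul_le_one₀ hb1 (by positivity) (pow_le_one₀ hnp.le hp1.le))
        exact (mul_le_of_le_one_left (norm_nonneg _) hb1).trans this
      rcases lt_or_ge 1 ‖z‖ with hz1 | hz1
      · have := ih (p * z) (by
          rw [norm_mul, pow_succ, mul_comm]
          exact mul_le_mul_of_nonneg_left ((pow_le_one₀ hnp.le hp1.le).trans hz1.le) hnp.le) (by
          rw [norm_mul]; calc _ = ‖z‖ * ‖p‖ ^ (n + 1) := by ring
            _ ≤ 1 := h2)
        rw [h z hz, norm_mul, norm_neg] at this
        exact (le_mul_of_one_le_left (norm_nonneg _) hz1.le).trans this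
      · exact hC z (by simpa using ⟨hz1, hzp⟩)
  have hb : ∀ z ≠ 0, ‖f z‖ ≤ C := by
    intro z hz
    have hnz : 0 < ‖z‖ := norm_pos_iff.mpr hz
    obtain ⟨n, hn⟩ := exists_pow_lt_of_lt_one (lt_min hnz (inv_pos.mpr hnz)) hp1
    refine hC' n z ?_ ?_
    · exact (pow_le_pow_of_le_one hnp.le hp1.le n.le_succ).trans (hn.le.trans (min_le_left _ _))
    · calc ‖z‖ * ‖p‖ ^ n ≤ ‖z‖ * ‖z‖⁻¹ := by
            gcongr; exact hn.le.trans (min_le_right _ _)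
        _ = 1 := mul_inv_cancel₀ hnz.ne'
  have hd : Differentiable ℂ fun z => f (Complex.exp z) := fun z =>
    (hf _ (Complex.exp_ne_zero z)).comp z Complex.differentiable_exp.differentiableAt
  have hbd : Bornology.IsBounded (Set.range fun z => f (Complex.exp z)) := by
    rw [isBounded_iff_forall_norm_le]
    exact ⟨C, by rintro _ ⟨z, rfl⟩; exact hb _ (Complex.exp_ne_zero z)⟩
  have hconst : ∀ x ≠ 0, f x = f 1 := by
    intro x hx
    have := hd.apply_eq_apply_of_bounded hbd (Complex.log x) 0
    simpa [Complex.exp_log hx] using this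
  have h1 := h 1 one_ne_zero
  rw [mul_one, hconst p hp] at h1
  rw [hconst a ha]
  linear_combination h1 / 2

/-- Since (q²z - q²c) f(q²z) = -q²z (z - c) f(z) and -q²z has a nonzero limit at c, vanishing
residues are transported by c ↦ q²c in both directions. -/
theorem tendsto_sub_mul_iff_of_quasiperiodic {q : ℂ} (hq : q ≠ 0) {f : ℂ → ℂ}
    (h : ∀ a ≠ 0, (∀ k : ℤ, a ≠ -q ^ k) → f (q ^ 2 * a) = -a * f a) {c : ℂ} (hc : c ≠ 0)
    (hcf : ∀ᶠ z in 𝓝[≠] c, z ≠ 0 ∧ ∀ k : ℤ, z ≠ -q ^ k) :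
    Tendsto (fun z => (z - q ^ 2 * c) * f z) (𝓝[≠] (q ^ 2 * c)) (𝓝 0) ↔
      Tendsto (fun z => (z - c) * f z) (𝓝[≠] c) (𝓝 0) := by
  have hq2 : q ^ 2 ≠ 0 := pow_ne_zero 2 hq
  have hmap : map (fun z => q ^ 2 * z) (𝓝[≠] c) = 𝓝[≠] (q ^ 2 * c) := by
    have := (Homeomorph.mulLeft₀ (q ^ 2) hq2).isEmbedding.map_nhdsWithin_eq {c}ᶜ c
    rw [Set.image_compl_eq (Homeomorph.mulLeft₀ (q ^ 2) hq2).bijective, Set.image_singleton] at this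
    exact this
  rw [← hmap, tendsto_map'_iff]
  have hid : Tendsto (fun z : ℂ => z) (𝓝[≠] c) (𝓝 c) := tendsto_id.mono_left nhdsWithin_le_nhds
  constructor
  · intro H
    have h1 : Tendsto (fun z : ℂ => -(q ^ 2)⁻¹ * z⁻¹) (𝓝[≠] c) (𝓝 (-(q ^ 2)⁻¹ * c⁻¹)) :=
      (hid.inv₀ hc).const_mul _
    have h2 := h1.mul H
    rw [mul_zero] at h2
    refine h2.congr' ?_
    filter_upwards [hcf] with z hz
    have hz0 := hz.1
    simp only [Function.comp_apply, h z hz.1 hz.2]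
    field_simp
  · intro H
    have h1 : Tendsto (fun z : ℂ => -(q ^ 2) * z) (𝓝[≠] c) (𝓝 (-(q ^ 2) * c)) :=
      hid.const_mul _
    have h2 := h1.mul H
    rw [mul_zero] at h2
    refine h2.congr' ?_
    filter_upwards [hcf] with z hz
    simp only [Function.comp_apply, h z hz.1 hz.2]
    ring

theorem eventually_ne_neg_zpow {q c : ℂ} (hq : q ≠ 0) (hq1 : ‖q‖ < 1) (hc : c ≠ 0) :
    ∀ᶠ z in 𝓝[≠] c, z ≠ 0 ∧ ∀ k : ℤ, z ≠ -q ^ k := by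
  obtain ⟨d, hd, h⟩ := exists_pos_le_norm_add_zpow hq hq1 hc
  have h1 : ∀ᶠ z in 𝓝[≠] c, z ∈ Metric.ball c d :=
    nhdsWithin_le_nhds (Metric.ball_mem_nhds c hd)
  have h2 : ∀ᶠ z in 𝓝[≠] c, z ≠ 0 := nhdsWithin_le_nhds (isOpen_ne.mem_nhds hc)
  filter_upwards [h1, h2, self_mem_nhdsWithin] with z hz hz0 hzc
  refine ⟨hz0, fun k hk => ?_⟩
  subst hk
  have hk : c + q ^ k ≠ 0 := fun e => hzc (by simp [eq_neg_of_add_eq_zero_left e])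
  have := h k hk
  rw [Metric.mem_ball, dist_comm, dist_eq_norm, sub_neg_eq_add] at hz
  linarith

/-- A function holomorphic on `ℂ \ {0}` away from the points `-q^k`, with no poles at `-1` and `-q`
and with `f (q² a) = -a f a`, vanishes. -/
theorem eq_zero_of_quasiperiodic_of_residues {q : ℂ} (hq : q ≠ 0) (hq1 : ‖q‖ < 1) {f : ℂ → ℂ}
    (hf : ∀ a ≠ 0, (∀ k : ℤ, a ≠ -q ^ k) → DifferentiableAt ℂ f a)
    (h : ∀ a ≠ 0, (∀ k : ℤ, a ≠ -q ^ k) → f (q ^ 2 * a) = -a * f a)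
    (h0 : Tendsto (fun z => (z - (-1)) * f z) (𝓝[≠] (-1)) (𝓝 0))
    (h1 : Tendsto (fun z => (z - (-q)) * f z) (𝓝[≠] (-q)) (𝓝 0)) {a : ℂ}
    (ha : a ≠ 0) (hgen : ∀ k : ℤ, a ≠ -q ^ k) : f a = 0 := by
  have hne : ∀ k : ℤ, -q ^ k ≠ 0 := fun k => neg_ne_zero.mpr (zpow_ne_zero k hq)
  have hstep : ∀ k : ℤ, Tendsto (fun z => (z - (-q ^ (k + 2))) * f z) (𝓝[≠] (-q ^ (k + 2))) (𝓝 0) ↔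
      Tendsto (fun z => (z - (-q ^ k)) * f z) (𝓝[≠] (-q ^ k)) (𝓝 0) := fun k => by
    have := tendsto_sub_mul_iff_of_quasiperiodic hq h (hne k)
      (eventually_ne_neg_zpow hq hq1 (hne k))
    rwa [show q ^ 2 * -q ^ k = -q ^ (k + 2) by rw [zpow_add₀ hq]; norm_cast; ring] at this
  -- The residues propagate in steps of two, so two consecutive exponents are carried through the
  -- induction.
  have hres2 : ∀ k : ℤ, Tendsto (fun z => (z - (-q ^ k)) * f z) (𝓝[≠] (-q ^ k)) (𝓝 0) ∧
      Tendsto (fun z => (z - (-q ^ (k + 1))) * f z) (𝓝[≠] (-q ^ (k + 1))) (𝓝 0) := by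
    intro k
    induction k using Int.induction_on with
    | zero => simpa using ⟨by simpa using h0, by simpa using h1⟩
    | succ k ih => exact ⟨ih.2, by simpa [add_assoc] using (hstep k).mpr ih.1⟩
    | pred k ih =>
      refine ⟨(hstep _).mp ?_, by simpa using ih.1⟩
      convert ih.2 using 4 <;> ring_nf
  -- The values of f at the points -q^k are arbitrary, so f is replaced by its punctured limits;
  -- Riemann's removable singularity theorem makes these holomorphic.
  have hd : ∀ c ≠ 0, DifferentiableAt ℂ (fun z => limUnder (𝓝[≠] z) f) c := by
    intro c hc
    obtain ⟨r, hr, hball⟩ := Metric.mem_nhdsWithin_iff.mp (eventually_ne_neg_zpow hq hq1 hc)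
    have hmem : ∀ z ∈ Metric.ball c r, z ≠ c → DifferentiableAt ℂ f z := fun z hz hzc =>
      hf z (hball ⟨hz, hzc⟩).1 (hball ⟨hz, hzc⟩).2
    have hres : Tendsto (fun z => (z - c) * f z) (𝓝[≠] c) (𝓝 0) := by
      by_cases hcS : ∀ k : ℤ, c ≠ -q ^ k
      · have hcont := (hf c hc hcS).continuousAt.tendsto.mono_left
          (nhdsWithin_le_nhds (s := {c}ᶜ))
        have hid : Tendsto (fun z : ℂ => z - c) (𝓝[≠] c) (𝓝 (c - c)) :=
          (tendsto_id.mono_left nhdsWithin_le_nhds).sub_const c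
        simpa using hid.mul hcont
      · push Not at hcS
        obtain ⟨k, rfl⟩ := hcS
        exact (hres2 k).1
    have ho : (fun z => f z - f c) =o[𝓝[≠] c] fun z => (z - c)⁻¹ := by
      rw [Asymptotics.isLittleO_iff_tendsto']
      · have hid : Tendsto (fun z : ℂ => (z - c) * f c) (𝓝[≠] c) (𝓝 ((c - c) * f c)) :=
          ((tendsto_id.mono_left nhdsWithin_le_nhds).sub_const c).mul_const _
        have := hres.sub hid
        simp only [sub_self, zero_mul] at this
        refine this.congr fun z => ?_
        rw [div_inv_eq_mul]; ring
      · filter_upwards [self_mem_nhdsWithin] with z hz hz0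
        exact absurd (sub_eq_zero.mp (inv_eq_zero.mp hz0)) hz
    have hU : Metric.ball c r ∈ 𝓝 c := Metric.ball_mem_nhds c hr
    have H := Complex.differentiableOn_update_limUnder_of_isLittleO hU
      (fun z hz => (hmem z hz.1 hz.2).differentiableWithinAt) ho
    refine (H.differentiableAt hU).congr_of_eventuallyEq ?_
    filter_upwards [hU] with z hz
    by_cases hzc : z = c
    · subst hzc; simp
    · rw [Function.update_of_ne hzc]
      exact ((hmem z hz hzc).continuousAt.tendsto.mono_left nhdsWithin_le_nhds).limUnder_eq
  have hq2 : q ^ 2 ≠ 0 := pow_ne_zero 2 hq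
  have hlim : ∀ c ≠ 0, (∀ k : ℤ, c ≠ -q ^ k) → limUnder (𝓝[≠] c) f = f c := fun c hc hcS =>
    ((hf c hc hcS).continuousAt.tendsto.mono_left nhdsWithin_le_nhds).limUnder_eq
  have hgen2 : ∀ c, (∀ k : ℤ, c ≠ -q ^ k) → ∀ k : ℤ, q ^ 2 * c ≠ -q ^ k := by
    intro c hcS k hk
    refine hcS (k - 2) (mul_left_cancel₀ hq2 ?_)
    rw [hk, zpow_sub₀ hq]
    norm_cast
    field_simp
  -- The functional equation is known only off the points -q^k and extends to them by continuity.
  have hL : ∀ c ≠ 0, limUnder (𝓝[≠] (q ^ 2 * c)) f = -c * limUnder (𝓝[≠] c) f := by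
    intro c hc
    have hcont : ContinuousAt (fun z => limUnder (𝓝[≠] (q ^ 2 * z)) f) c :=
      ContinuousAt.comp (g := fun z => limUnder (𝓝[≠] z) f) (f := fun z => q ^ 2 * z)
        (hd _ (mul_ne_zero hq2 hc)).continuousAt (by fun_prop)
    have hcont2 : ContinuousAt (fun z => -z * limUnder (𝓝[≠] z) f) c :=
      continuousAt_id.neg.mul (hd c hc).continuousAt
    refine tendsto_nhds_unique (hcont.tendsto.mono_left (nhdsWithin_le_nhds (s := {c}ᶜ)))
      ((hcont2.tendsto.mono_left nhdsWithin_le_nhds).congr' ?_)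
    filter_upwards [eventually_ne_neg_zpow hq hq1 hc] with z hz
    rw [hlim z hz.1 hz.2, hlim _ (mul_ne_zero hq2 hz.1) (hgen2 z hz.2), h z hz.1 hz.2]
  rw [← hlim a ha hgen]
  exact eq_zero_of_quasiperiodic hq2 (norm_sq_lt_one hq1) hd hL ha

/-! ### Partial fractions of m(a,q,-1) -/

/-- The sum `∑_{s ∈ ℤ} w_s / (a + q^s)`. -/
noncomputable def poleSum (w : ℤ → ℂ) (q a : ℂ) : ℂ := ∑' s : ℤ, w s / (a + q ^ s)

theorem summable_poleSum {w : ℤ → ℂ} (hw : Summable fun s => ‖w s‖) {q a : ℂ} (hq : q ≠ 0)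
    (hq1 : ‖q‖ < 1) (ha : a ≠ 0) : Summable fun s : ℤ => w s / (a + q ^ s) := by
  obtain ⟨d, hd, h⟩ := exists_pos_le_norm_add_zpow hq hq1 ha
  refine Summable.of_norm_bounded (hw.mul_right d⁻¹) fun s => ?_
  rw [norm_div, ← div_eq_mul_inv]
  by_cases hs : a + q ^ s = 0
  · rw [hs, norm_zero, div_zero]; positivity
  · exact div_le_div_of_nonneg_left (norm_nonneg _) hd (h s hs)

/-- Only indices of nonzero weight must avoid a pole, so the lemma still applies at -q^k once the
weight at k is set to zero. -/
theorem differentiableAt_poleSum {w : ℤ → ℂ} (hw : Summable fun s => ‖w s‖) {q a : ℂ}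
    (hq : q ≠ 0) (hq1 : ‖q‖ < 1) (ha : a ≠ 0) (haw : ∀ s, w s ≠ 0 → a + q ^ s ≠ 0) :
    DifferentiableAt ℂ (poleSum w q) a := by
  obtain ⟨d, hd, h⟩ := exists_pos_le_norm_add_zpow hq hq1 ha
  have hlow : ∀ s, w s ≠ 0 → ∀ z ∈ Metric.ball a (d / 2), d / 2 ≤ ‖z + q ^ s‖ := by
    intro s hs z hz
    have h1 := h s (haw s hs)
    have h2 := norm_sub_le (z + q ^ s) (z - a)
    rw [show z + q ^ s - (z - a) = a + q ^ s by ring] at h2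
    rw [Metric.mem_ball, dist_eq_norm] at hz
    linarith
  have hd2 := half_pos hd
  have H := Complex.differentiableOn_tsum_of_summable_norm (U := Metric.ball a (d / 2))
    (F := fun (s : ℤ) z => w s / (z + q ^ s)) (hw.mul_right (d / 2)⁻¹) (fun s => ?_)
    Metric.isOpen_ball (fun s z hz => ?_)
  · exact H.differentiableAt (Metric.ball_mem_nhds a hd2)
  · by_cases hs : w s = 0
    · simp only [hs, zero_div]; exact differentiableOn_const 0
    · exact (differentiableOn_const _).div (by fun_prop) fun z hz =>
        norm_pos_iff.mp (hd2.trans_le (hlow s hs z hz))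
  · by_cases hs : w s = 0
    · simp [hs]
    · rw [norm_div, ← div_eq_mul_inv]
      exact div_le_div_of_nonneg_left (norm_nonneg _) hd2 (hlow s hs z hz)

theorem zpow_injective_of_norm_lt_one {q : ℂ} (hq : q ≠ 0) (hq1 : ‖q‖ < 1) :
    Function.Injective fun k : ℤ => q ^ k := by
  intro k l hkl
  have := congrArg norm hkl
  simp only [norm_zpow] at this
  exact zpow_right_injective₀ (norm_pos_iff.mpr hq) hq1.ne this

/-- The residue of `poleSum w q` at `-q^k` is `w k`. -/
theorem tendsto_mul_poleSum {w : ℤ → ℂ} (hw : Summable fun s => ‖w s‖) {q : ℂ}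
    (hq : q ≠ 0) (hq1 : ‖q‖ < 1) (k : ℤ) :
    Tendsto (fun z => (z - (-q ^ k)) * poleSum w q z) (𝓝[≠] (-q ^ k)) (𝓝 (w k)) := by
  have hk : -q ^ k ≠ 0 := neg_ne_zero.mpr (zpow_ne_zero k hq)
  -- With the k-th term removed the sum is regular at -q^k, and the removed term contributes exactly
  -- w_k.
  set v : ℤ → ℂ := fun s => if s = k then 0 else w s with hv
  have hvs : Summable fun s => ‖v s‖ := by
    refine Summable.of_nonneg_of_le (fun _ => norm_nonneg _) (fun s => ?_) hw
    by_cases hs : s = k <;> simp [hv, hs]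
  have hd := differentiableAt_poleSum hvs hq hq1 hk fun s hs h0 => by
    have : s = k := zpow_injective_of_norm_lt_one hq hq1 (by linear_combination h0)
    simp [hv, this] at hs
  have hid : Tendsto (fun z : ℂ => z - (-q ^ k)) (𝓝[≠] (-q ^ k)) (𝓝 (-q ^ k - (-q ^ k))) :=
    (tendsto_id.mono_left nhdsWithin_le_nhds).sub_const _
  have H := (hid.mul (hd.continuousAt.tendsto.mono_left nhdsWithin_le_nhds)).const_add (w k)
  rw [sub_self, zero_mul, add_zero] at H
  refine H.congr' ?_
  filter_upwards [eventually_ne_neg_zpow hq hq1 hk, self_mem_nhdsWithin] with z hz hzk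
  have hz' : z + q ^ k ≠ 0 := fun e => hzk (eq_neg_of_add_eq_zero_left e)
  have := (summable_poleSum hw hq hq1 hz.1).tsum_eq_add_tsum_ite k
  rw [show poleSum w q z = _ from this]
  have e : (∑' s : ℤ, if s = k then 0 else w s / (z + q ^ s)) = poleSum v q z :=
    tsum_congr fun s => by by_cases hs : s = k <;> simp [hv, hs]
  rw [e, sub_neg_eq_add, mul_add, mul_div_cancel₀ _ hz']

theorem triWeight_succ {q : ℂ} (hq : q ≠ 0) (s : ℤ) :
    triWeight q (s + 1) = triWeight q s * q ^ (s + 1) := by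
  rw [triWeight, triWeight, ← zpow_add₀ hq]
  congr 1
  rw [show (s + 1) * (s + 1 + 1) = s * (s + 1) + (s + 1) * 2 by ring,
    Int.add_mul_ediv_right _ _ (by norm_num)]

/-- Shifting s by one turns each term into w_s q^s/(a + q^s) = w_s - a w_s/(a + q^s), and the w_s
add up to j(-1;q). -/
theorem poleSum_triWeight_mul {q a : ℂ} (hq : q ≠ 0) (hq1 : ‖q‖ < 1) (ha : a ≠ 0)
    (hgen : ∀ k : ℤ, a ≠ -q ^ k) :
    poleSum (triWeight q) q (q * a) = thetaJ (-1) q - a * poleSum (triWeight q) q a := by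
  have hw := summable_triWeight hq1
  rw [← tsum_triWeight hq1, poleSum, poleSum, ← tsum_mul_left, ← hw.of_norm.tsum_sub
    ((summable_poleSum hw hq hq1 ha).mul_left a), ← (Equiv.addRight (1 : ℤ)).tsum_eq]
  refine tsum_congr fun s => ?_
  have h1 : a + q ^ s ≠ 0 := fun e => hgen s (eq_neg_of_add_eq_zero_left e)
  rw [Equiv.coe_addRight, triWeight_succ hq, zpow_add_one₀ hq,
    show q * a + q ^ s * q = q * (a + q ^ s) by ring]
  field_simp
  ring

/-- Substitute r = 1 - s: the signs cancel, and q^(-s) is common to the numerator and the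
denominator. -/
theorem appellLerch_neg_one (a : ℂ) {q : ℂ} (hq : q ≠ 0) :
    appellLerch a q (-1) = 1 / thetaJ (-1) q * poleSum (triWeight q) q a := by
  rw [appellLerch, poleSum, ← (Equiv.subLeft (1 : ℤ)).tsum_eq]
  congr 1
  refine tsum_congr fun s => ?_
  rw [Equiv.subLeft_apply, appellLerchTerm, mul_right_comm, ← zpow_add₀ (by norm_num),
    Even.neg_one_zpow (Even.add_self _), one_mul, show (1 - s) * (1 - s - 1) = s * (s + 1) - s * 2 by ring,
    Int.sub_mul_ediv_right _ _ (by norm_num), zpow_sub₀ hq,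
    show 1 - s - 1 = -s by ring, zpow_neg, triWeight]
  have := zpow_ne_zero s hq
  rw [div_div]
  congr 1
  field_simp
  ring

theorem neg_one_ne_zpow {q : ℂ} (hq : q ≠ 0) (hq1 : ‖q‖ < 1) (k : ℤ) : (-1 : ℂ) ≠ q ^ k := by
  intro h
  have h2 : q ^ (2 * k) = q ^ (0 : ℤ) := by rw [mul_comm, zpow_mul, ← h]; norm_num
  have h3 : k = 0 := by have := zpow_injective_of_norm_lt_one hq hq1 h2; omega
  rw [h3, zpow_zero] at h
  norm_num at h

theorem thetaJ_neg_one_ne_zero {q : ℂ} (hq : q ≠ 0) (hq1 : ‖q‖ < 1) : thetaJ (-1) q ≠ 0 :=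
  thetaJ_ne_zero hq hq1 (by norm_num) (neg_one_ne_zpow hq hq1)

theorem appellLerch_neg_one_mul {q a : ℂ} (hq : q ≠ 0) (hq1 : ‖q‖ < 1) (ha : a ≠ 0)
    (hgen : ∀ k : ℤ, a ≠ -q ^ k) :
    appellLerch (q * a) q (-1) = 1 - a * appellLerch a q (-1) := by
  have := thetaJ_neg_one_ne_zero hq hq1
  rw [appellLerch_neg_one _ hq, appellLerch_neg_one _ hq, poleSum_triWeight_mul hq hq1 ha hgen]
  field_simp

theorem differentiableAt_appellLerch_neg_one {q a : ℂ} (hq : q ≠ 0) (hq1 : ‖q‖ < 1) (ha : a ≠ 0)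
    (hgen : ∀ k : ℤ, a ≠ -q ^ k) : DifferentiableAt ℂ (fun a => appellLerch a q (-1)) a := by
  simp only [appellLerch_neg_one _ hq]
  exact (differentiableAt_poleSum (summable_triWeight hq1) hq hq1 ha fun s _ e =>
    hgen s (eq_neg_of_add_eq_zero_left e)).const_mul _

theorem tendsto_mul_appellLerch_neg_one {q : ℂ} (hq : q ≠ 0) (hq1 : ‖q‖ < 1) (k : ℤ) :
    Tendsto (fun z => (z - (-q ^ k)) * appellLerch z q (-1)) (𝓝[≠] (-q ^ k))
      (𝓝 (triWeight q k / thetaJ (-1) q)) := by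
  have := (tendsto_mul_poleSum (summable_triWeight hq1) hq hq1 k).div_const (thetaJ (-1) q)
  refine this.congr fun z => ?_
  rw [appellLerch_neg_one _ hq]
  ring

/-! ### The q-hypergeometric side -/

/-- The terms of the `q`-hypergeometric series. -/
noncomputable def eulerianTerm (q a : ℂ) (n : ℕ) : ℂ :=
  qPoch (a * q) (q ^ 2) n * qPoch (q / a) (q ^ 2) n * q ^ (2 * n + 1) / qPoch (-q) q (2 * n + 1)

/-- A geometric majorant uniform on annuli gives both absolute convergence and holomorphy in a. -/
theorem exists_norm_eulerianTerm_le {q : ℂ} (hq1 : ‖q‖ < 1) {r R : ℝ} (hr : 0 < r) :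
    ∃ C : ℝ, ∀ a : ℂ, r ≤ ‖a‖ → ‖a‖ ≤ R → ∀ n, ‖eulerianTerm q a n‖ ≤ C * (‖q‖ ^ 2) ^ n := by
  have hq2 := norm_sq_lt_one hq1
  have hnq : ‖-q‖ < 1 := by rwa [norm_neg]
  obtain ⟨B, hB0, hB⟩ := exists_norm_le_of_tendsto
    ((qPoch_tendsto hq1 (-q)).inv₀ (qPochInf_ne_zero_of_norm_lt hq1 hnq))
  refine ⟨Real.exp (R * ‖q‖ / (1 - ‖q ^ 2‖)) * Real.exp (‖q‖ / r / (1 - ‖q ^ 2‖)) * B,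
    fun a har haR n => ?_⟩
  have hpos : 0 < 1 - ‖q ^ 2‖ := by linarith
  rw [eulerianTerm, div_eq_mul_inv, norm_mul, norm_mul, norm_mul]
  have h1 : ‖qPoch (a * q) (q ^ 2) n‖ ≤ Real.exp (R * ‖q‖ / (1 - ‖q ^ 2‖)) := by
    refine (norm_qPoch_le hq2 _ n).trans ?_
    rw [norm_mul]; gcongr
  have h2 : ‖qPoch (q / a) (q ^ 2) n‖ ≤ Real.exp (‖q‖ / r / (1 - ‖q ^ 2‖)) := by
    refine (norm_qPoch_le hq2 _ n).trans ?_
    rw [norm_div]; gcongr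
  have h3 : ‖q ^ (2 * n + 1)‖ ≤ (‖q‖ ^ 2) ^ n := by
    rw [norm_pow, ← pow_mul]
    exact pow_le_pow_of_le_one (norm_nonneg q) hq1.le (by omega)
  calc _ ≤ Real.exp (R * ‖q‖ / (1 - ‖q ^ 2‖)) * Real.exp (‖q‖ / r / (1 - ‖q ^ 2‖)) *
        (‖q‖ ^ 2) ^ n * B := by
        gcongr; exact hB (2 * n + 1)
    _ = _ := by ring

theorem summable_norm_sq_pow {q : ℂ} (hq1 : ‖q‖ < 1) : Summable fun n : ℕ => (‖q‖ ^ 2) ^ n :=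
  summable_geometric_of_lt_one (by positivity) (by rw [← norm_pow]; exact norm_sq_lt_one hq1)

theorem summable_eulerianTerm {q a : ℂ} (hq1 : ‖q‖ < 1) (ha : a ≠ 0) :
    Summable (eulerianTerm q a) := by
  obtain ⟨C, hC⟩ := exists_norm_eulerianTerm_le hq1 (R := ‖a‖) (norm_pos_iff.mpr ha)
  exact Summable.of_norm_bounded ((summable_norm_sq_pow hq1).mul_left C) (hC a le_rfl le_rfl)

theorem differentiableAt_tsum_eulerianTerm {q a : ℂ} (hq1 : ‖q‖ < 1) (ha : a ≠ 0) :
    DifferentiableAt ℂ (fun a => ∑' n, eulerianTerm q a n) a := by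
  have hna : 0 < ‖a‖ := norm_pos_iff.mpr ha
  obtain ⟨C, hC⟩ := exists_norm_eulerianTerm_le hq1 (half_pos hna) (R := 2 * ‖a‖)
  have hlow : ∀ z ∈ Metric.ball a (‖a‖ / 2), ‖a‖ / 2 ≤ ‖z‖ ∧ ‖z‖ ≤ 2 * ‖a‖ := by
    intro z hz
    rw [Metric.mem_ball, dist_eq_norm] at hz
    have h1 := norm_sub_norm_le z a
    have h2 := norm_sub_norm_le a z
    rw [norm_sub_rev] at h2
    constructor <;> linarith
  have H := Complex.differentiableOn_tsum_of_summable_norm (U := Metric.ball a (‖a‖ / 2))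
    (F := fun (n : ℕ) z => eulerianTerm q z n) ((summable_norm_sq_pow hq1).mul_left C)
    (fun n z hz => ?_) Metric.isOpen_ball (fun n z hz => hC z (hlow z hz).1 (hlow z hz).2 n)
  · exact H.differentiableAt (Metric.ball_mem_nhds a (half_pos hna))
  · have hz0 : z ≠ 0 := norm_pos_iff.mp ((half_pos hna).trans_le (hlow z hz).1)
    have hd := differentiable_qPoch (q ^ 2) n
    have h1 : DifferentiableAt ℂ (fun z => qPoch (z * q) (q ^ 2) n) z :=
      DifferentiableAt.comp (g := fun x => qPoch x (q ^ 2) n) z (hd _) (by fun_prop)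
    have h2 : DifferentiableAt ℂ (fun z => qPoch (q / z) (q ^ 2) n) z :=
      DifferentiableAt.comp (g := fun x => qPoch x (q ^ 2) n) z (hd _)
        ((differentiableAt_const q).div differentiableAt_id hz0)
    exact (((h1.mul h2).mul_const _).div_const _).differentiableWithinAt

/-- The Pochhammer symbols at q²a and at a differ by boundary factors only, so the combined term is
a difference of consecutive values of the closed form. -/
theorem sum_eulerianTerm_telescope {q a : ℂ} (hq : q ≠ 0) (hq1 : ‖q‖ < 1) (ha : a ≠ 0) (n : ℕ) :
    ∑ i ∈ Finset.range n, ((1 + q ^ 2 * a) / (q ^ 2 * a) * eulerianTerm q (q ^ 2 * a) i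
      + (1 + a) * eulerianTerm q a i) =
    2 - (1 + q ^ (2 * n)) * qPoch (a * q) (q ^ 2) n * qPoch (1 / (q * a)) (q ^ 2) n
      / qPoch (-q) q (2 * n) := by
  have hnq : ‖-q‖ < 1 := by rwa [norm_neg]
  induction n with
  | zero => simp [qPoch]; norm_num
  | succ n ih =>
    have e1 : qPoch (a * q) (q ^ 2) n * (1 - (q ^ 2) ^ n * (a * q)) =
        (1 - a * q) * qPoch (q ^ 2 * a * q) (q ^ 2) n := by
      rw [← qPoch_succ, qPoch_succ']; ring_nf
    have e2 : qPoch (1 / (q * a)) (q ^ 2) n * (1 - (q ^ 2) ^ n * (1 / (q * a))) =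
        (1 - 1 / (q * a)) * qPoch (q / a) (q ^ 2) n := by
      rw [← qPoch_succ, qPoch_succ']
      congr 2
      field_simp
    have e3 : q / (q ^ 2 * a) = 1 / (q * a) := by field_simp
    have hD := qPoch_ne_zero_of_norm_lt hq1 hnq (2 * n)
    have hD1 : 1 + q ^ (2 * n + 1) ≠ 0 := by
      have := pow_mul_ne_one_of_norm_lt hq1 hnq (2 * n)
      intro h; apply this; linear_combination -h
    have hD2 : 1 + q ^ (2 * n + 2) ≠ 0 := by
      have := pow_mul_ne_one_of_norm_lt hq1 hnq (2 * n + 1)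
      intro h; apply this; linear_combination -h
    rw [Finset.sum_range_succ, ih, eulerianTerm, eulerianTerm, e3,
      show 2 * (n + 1) = 2 * n + 1 + 1 by ring, qPoch_succ (-q) q (2 * n + 1),
      qPoch_succ (-q) q (2 * n), qPoch_succ (a * q), qPoch_succ (1 / (q * a))]
    rw [show 1 - q ^ (2 * n) * -q = 1 + q ^ (2 * n + 1) by ring,
      show 1 - q ^ (2 * n + 1) * -q = 1 + q ^ (2 * n + 2) by ring]
    have key : -(1 + q ^ (2 * n)) * (1 + q ^ (2 * n + 1)) *
        (qPoch (a * q) (q ^ 2) n * qPoch (1 / (q * a)) (q ^ 2) n) + q ^ (2 * n + 1) *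
        ((1 + q ^ 2 * a) / (q ^ 2 * a) *
          (qPoch (q ^ 2 * a * q) (q ^ 2) n * qPoch (1 / (q * a)) (q ^ 2) n)
        + (1 + a) * (qPoch (a * q) (q ^ 2) n * qPoch (q / a) (q ^ 2) n)) =
        -(qPoch (a * q) (q ^ 2) n * (1 - (q ^ 2) ^ n * (a * q)) *
          (qPoch (1 / (q * a)) (q ^ 2) n * (1 - (q ^ 2) ^ n * (1 / (q * a))))) := by
      -- The generic argument divides by 1 - aq. If aq = 1, every product vanishes for n ≥ 1, and n
      -- = 0 is checked directly.
      by_cases haq : a * q = 1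
      · rcases n with _ | n
        · have : a = 1 / q := by field_simp; exact haq
          subst this
          simp [qPoch]
          field_simp
          ring
        · have z1 : qPoch (a * q) (q ^ 2) (n + 1) = 0 := by rw [qPoch_succ', haq]; simp
          have z2 : qPoch (1 / (q * a)) (q ^ 2) (n + 1) = 0 := by
            rw [qPoch_succ', mul_comm q a, haq]; simp
          rw [z1, z2]
          ring
      · have h1 : 1 - a * q ≠ 0 := sub_ne_zero.mpr (Ne.symm haq)
        have h2 : a * q - 1 ≠ 0 := sub_ne_zero.mpr haq
        have e2' : qPoch (1 / (q * a)) (q ^ 2) n * (a * q - (q ^ 2) ^ n) =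
            (a * q - 1) * qPoch (q / a) (q ^ 2) n := by
          have e : ∀ y : ℂ, a * q - y = a * q * (1 - y * (1 / (q * a))) := fun y => by
            field_simp
          rw [e, show a * q - 1 = a * q * (1 - 1 / (q * a)) by rw [e 1, one_mul]]
          linear_combination a * q * e2
        have f1 : qPoch (q ^ 2 * a * q) (q ^ 2) n =
            qPoch (a * q) (q ^ 2) n * (1 - (q ^ 2) ^ n * (a * q)) / (1 - a * q) := by
          rw [eq_div_iff h1]; linear_combination -e1
        have f2 : qPoch (q / a) (q ^ 2) n =
            qPoch (1 / (q * a)) (q ^ 2) n * (a * q - (q ^ 2) ^ n) / (a * q - 1) := by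
          rw [eq_div_iff h2]; linear_combination -e2'
        rw [f1, f2, pow_succ, pow_mul]
        generalize qPoch (a * q) (q ^ 2) n = A
        generalize qPoch (1 / (q * a)) (q ^ 2) n = B
        generalize (q ^ 2) ^ n = x
        have h3 : 1 - q * a ≠ 0 := by rwa [mul_comm]
        rw [show a * q - 1 = -(1 - q * a) by ring, show 1 - a * q = 1 - q * a by ring]
        field_simp
        ring
    generalize qPoch (a * q) (q ^ 2) n * (1 - (q ^ 2) ^ n * (a * q)) = A₁ at *
    generalize qPoch (1 / (q * a)) (q ^ 2) n * (1 - (q ^ 2) ^ n * (1 / (q * a))) = B₁ at *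
    rw [show 2 * n + 1 + 1 = 2 * n + 2 by ring]
    generalize qPoch (-q) q (2 * n) = D at *
    generalize (1 + q ^ 2 * a) / (q ^ 2 * a) = c at *
    generalize 1 + q ^ (2 * n + 2) = E at *
    generalize 1 + q ^ (2 * n + 1) = F at *
    generalize qPoch (q ^ 2 * a * q) (q ^ 2) n = A' at *
    generalize qPoch (q / a) (q ^ 2) n = B' at *
    generalize qPoch (a * q) (q ^ 2) n = A at *
    generalize qPoch (1 / (q * a)) (q ^ 2) n = B at *
    field_simp
    linear_combination key

/-- The limit of the telescoped sums, rewritten with J̄_{1,4} = J_2 (-q;q)_∞. -/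
theorem eulerianTerm_quasiperiodic {q a : ℂ} (hq : q ≠ 0) (hq1 : ‖q‖ < 1) (ha : a ≠ 0) :
    (1 + 1 / (q ^ 2 * a)) * ∑' n, eulerianTerm q (q ^ 2 * a) n
      + a * ((1 + 1 / a) * ∑' n, eulerianTerm q a n) =
    2 - (1 - 1 / (a * q)) * (thetaJ (a * q) (q ^ 2) / thetaJBar 1 4 q) := by
  have hq2 := norm_sq_lt_one hq1
  have hq2a : q ^ 2 * a ≠ 0 := mul_ne_zero (pow_ne_zero 2 hq) ha
  have hnq : ‖-q‖ < 1 := by rwa [norm_neg]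
  have h2 : Tendsto (fun n : ℕ => 2 * n) atTop atTop := tendsto_id.const_mul_atTop' two_pos
  have hD := qPochInf_ne_zero_of_norm_lt hq1 hnq
  have L := (((summable_eulerianTerm hq1 hq2a).mul_left ((1 + q ^ 2 * a) / (q ^ 2 * a))).add
    ((summable_eulerianTerm hq1 ha).mul_left (1 + a))).hasSum.tendsto_sum_nat
  simp only [sum_eulerianTerm_telescope hq hq1 ha] at L
  rw [Summable.tsum_add ((summable_eulerianTerm hq1 hq2a).mul_left _)
    ((summable_eulerianTerm hq1 ha).mul_left _), tsum_mul_left, tsum_mul_left] at L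
  have hx : Tendsto (fun n : ℕ => 1 + q ^ (2 * n)) atTop (𝓝 (1 + 0)) :=
    ((tendsto_pow_atTop_nhds_zero_of_norm_lt_one hq1).comp h2).const_add 1
  have R := (((hx.mul (qPoch_tendsto hq2 (a * q))).mul (qPoch_tendsto hq2 (1 / (q * a)))).div
    ((qPoch_tendsto hq1 (-q)).comp h2) hD).const_sub 2
  have E := tendsto_nhds_unique L R
  have e1 : qPochInf (1 / (q * a)) (q ^ 2) = (1 - 1 / (a * q)) * qPochInf (q / a) (q ^ 2) := by
    rw [qPochInf_eq_mul hq2, mul_comm q a]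
    congr 2
    field_simp
  have hJ1 : eulerJ 1 q ≠ 0 := eulerJ_ne_zero hq1 one_ne_zero
  have hB := thetaJBar_mul hq hq1
  have hJ2 := qPochInf_neg_self_mul_eulerJ hq1
  have e2 : thetaJ (a * q) (q ^ 2) / thetaJBar 1 4 q =
      qPochInf (a * q) (q ^ 2) * qPochInf (q / a) (q ^ 2) / qPochInf (-q) q := by
    rw [← hJ2] at hB
    have hB' : thetaJBar 1 4 q = qPochInf (-q) q ^ 2 * eulerJ 1 q :=
      mul_right_cancel₀ hJ1 (by rw [hB]; ring)
    rw [hB', thetaJ, show qPochInf (q ^ 2) (q ^ 2) = eulerJ 2 q from rfl, ← hJ2,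
      show q ^ 2 / (a * q) = q / a by field_simp]
    field_simp
  rw [e1, add_zero, one_mul] at E
  rw [e2, ← mul_assoc, mul_add a, mul_one, mul_one_div_cancel ha, add_comm a 1,
    show 1 + 1 / (q ^ 2 * a) = (1 + q ^ 2 * a) / (q ^ 2 * a) by field_simp; ring, E]
  ring

/-! ### Functional equation and residues of the Appell–Lerch side -/

/-- The Appell–Lerch side of the identity. -/
noncomputable def appellLerchSide (q a : ℂ) : ℂ :=
  2 * appellLerch a (q ^ 2) (-1)
    - thetaJ (a * q) (q ^ 2) / thetaJBar 1 4 q * appellLerch a q (-1)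
    - 1 / 2 * (eulerJ 1 q ^ 5 / eulerJ 2 q ^ 4) * (thetaJ (a * q) (q ^ 2) / thetaJ (-a) q)

theorem ne_neg_zpow_mul {q a : ℂ} (hq : q ≠ 0) (hgen : ∀ k : ℤ, a ≠ -q ^ k) (k : ℤ) :
    q * a ≠ -q ^ k := by
  intro hk
  refine hgen (k - 1) (mul_left_cancel₀ hq ?_)
  rw [hk, zpow_sub₀ hq]
  field_simp

theorem ne_neg_zpow_sq {q a : ℂ} (hgen : ∀ k : ℤ, a ≠ -q ^ k) (k : ℤ) : a ≠ -(q ^ 2) ^ k := by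
  have := hgen (2 * k)
  rwa [zpow_mul, zpow_ofNat] at this

theorem thetaJ_neg_ne_zero {q a : ℂ} (hq : q ≠ 0) (hq1 : ‖q‖ < 1) (ha : a ≠ 0)
    (hgen : ∀ k : ℤ, a ≠ -q ^ k) : thetaJ (-a) q ≠ 0 :=
  thetaJ_ne_zero hq hq1 (neg_ne_zero.mpr ha) fun k hk => hgen k (by rw [← hk, neg_neg])

/-- The first term accounts for the 2 and the second for the theta quotient, by two applications of
the shift a ↦ qa; the third solves the homogeneous equation. -/
theorem appellLerchSide_quasiperiodic {q a : ℂ} (hq : q ≠ 0) (hq1 : ‖q‖ < 1) (ha : a ≠ 0)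
    (hgen : ∀ k : ℤ, a ≠ -q ^ k) :
    appellLerchSide q (q ^ 2 * a) + a * appellLerchSide q a =
      2 - (1 - 1 / (a * q)) * (thetaJ (a * q) (q ^ 2) / thetaJBar 1 4 q) := by
  have hqa : q * a ≠ 0 := mul_ne_zero hq ha
  have hq2 : q ^ 2 ≠ 0 := pow_ne_zero 2 hq
  have h1 := appellLerch_neg_one_mul hq2 (norm_sq_lt_one hq1) ha (ne_neg_zpow_sq hgen)
  have h2 := appellLerch_neg_one_mul hq hq1 ha hgen
  have h3 := appellLerch_neg_one_mul hq hq1 hqa (ne_neg_zpow_mul hq hgen)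
  have h4 := thetaJ_mul hq2 (norm_sq_lt_one hq1) (mul_ne_zero ha hq)
  have h5 := thetaJ_mul hq hq1 (neg_ne_zero.mpr ha)
  have h6 := thetaJ_mul hq hq1 (neg_ne_zero.mpr hqa)
  have h7 := thetaJ_neg_ne_zero hq hq1 ha hgen
  rw [mul_neg] at h5 h6
  rw [h5] at h6
  rw [h2, ← mul_assoc, ← sq] at h3
  rw [← mul_assoc, ← sq] at h6
  rw [← mul_assoc] at h4
  unfold appellLerchSide
  rw [h1, h3, h4, h6]
  generalize thetaJBar 1 4 q = J
  generalize eulerJ 1 q ^ 5 / eulerJ 2 q ^ 4 = C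
  field_simp
  ring

theorem differentiableAt_thetaJ_mul {q a : ℂ} (hq : q ≠ 0) (hq1 : ‖q‖ < 1) (ha : a ≠ 0) :
    DifferentiableAt ℂ (fun z => thetaJ (z * q) (q ^ 2)) a :=
  DifferentiableAt.comp (g := fun x => thetaJ x (q ^ 2)) a
    (differentiableAt_thetaJ (norm_sq_lt_one hq1) (mul_ne_zero ha hq)) (by fun_prop)

theorem differentiableAt_appellLerchSide {q a : ℂ} (hq : q ≠ 0) (hq1 : ‖q‖ < 1) (ha : a ≠ 0)
    (hgen : ∀ k : ℤ, a ≠ -q ^ k) : DifferentiableAt ℂ (appellLerchSide q) a := by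
  have h1 := differentiableAt_appellLerch_neg_one (pow_ne_zero 2 hq) (norm_sq_lt_one hq1) ha
    (ne_neg_zpow_sq hgen)
  have h2 := differentiableAt_appellLerch_neg_one hq hq1 ha hgen
  have h3 := differentiableAt_thetaJ_mul hq hq1 ha
  have h4 : DifferentiableAt ℂ (fun z => thetaJ (-z) q) a :=
    DifferentiableAt.comp (g := fun x => thetaJ x q) a
      (differentiableAt_thetaJ hq1 (neg_ne_zero.mpr ha)) (by fun_prop)
  exact ((h1.const_mul 2).sub ((h3.div_const _).mul h2)).sub
    ((h3.div h4 (thetaJ_neg_ne_zero hq hq1 ha hgen)).const_mul _)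

/-- The zero of j(-z;q) at -1 is the first factor 1 + z of (-z;q)_∞; the rest tends to J_1³. -/
theorem tendsto_add_one_div_thetaJ_neg {q : ℂ} (hq1 : ‖q‖ < 1) :
    Tendsto (fun z => (z - (-1)) / thetaJ (-z) q) (𝓝[≠] (-1)) (𝓝 (1 / eulerJ 1 q ^ 3)) := by
  have hJ : qPochInf q q = eulerJ 1 q := by simp [eulerJ]
  have hJ1 : eulerJ 1 q ≠ 0 := eulerJ_ne_zero hq1 one_ne_zero
  have hd := differentiable_qPochInf hq1
  have c1 : ContinuousAt (fun z => qPochInf (q * -z) q) (-1) :=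
    ContinuousAt.comp (g := fun x => qPochInf x q) (hd _).continuousAt (by fun_prop)
  have c2 : ContinuousAt (fun z => qPochInf (q / -z) q) (-1) :=
    ContinuousAt.comp (g := fun x => qPochInf x q) (hd _).continuousAt
      (continuousAt_const.div (by fun_prop) (by norm_num))
  have H := ((c1.mul c2).mul_const (eulerJ 1 q)).inv₀ (by simp [hJ, hJ1])
  have H' : Tendsto (fun z => (qPochInf (q * -z) q * qPochInf (q / -z) q * eulerJ 1 q)⁻¹)
      (𝓝[≠] (-1)) (𝓝 (qPochInf (q * -(-1)) q * qPochInf (q / -(-1)) q * eulerJ 1 q)⁻¹) :=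
    H.tendsto.mono_left nhdsWithin_le_nhds
  simp only [neg_neg, mul_one, div_one, hJ] at H'
  rw [one_div, pow_three']
  refine H'.congr' ?_
  filter_upwards [self_mem_nhdsWithin] with z hz
  have hz' : 1 + z ≠ 0 := fun e => hz (by simp; linear_combination e)
  rw [thetaJ, qPochInf_eq_mul hq1 (-z), hJ, sub_neg_eq_add, sub_neg_eq_add, add_comm z 1,
    mul_assoc (1 + z), mul_assoc (1 + z), div_mul_eq_div_div, div_self hz', one_div]

/-- Here the zero is the first factor (z + q)/z of (-q/z;q)_∞, whence the extra -q. -/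
theorem tendsto_add_self_div_thetaJ_neg {q : ℂ} (hq : q ≠ 0) (hq1 : ‖q‖ < 1) :
    Tendsto (fun z => (z - (-q)) / thetaJ (-z) q) (𝓝[≠] (-q)) (𝓝 (-q / eulerJ 1 q ^ 3)) := by
  have hJ : qPochInf q q = eulerJ 1 q := by simp [eulerJ]
  have hJ1 : eulerJ 1 q ≠ 0 := eulerJ_ne_zero hq1 one_ne_zero
  have hd := differentiable_qPochInf hq1
  have hnq : -q ≠ 0 := neg_ne_zero.mpr hq
  have c1 : ContinuousAt (fun z => qPochInf (-z) q) (-q) :=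
    ContinuousAt.comp (g := fun x => qPochInf x q) (hd _).continuousAt (by fun_prop)
  have c2 : ContinuousAt (fun z => qPochInf (q * (q / -z)) q) (-q) :=
    ContinuousAt.comp (g := fun x => qPochInf x q) (hd _).continuousAt
      (continuousAt_const.mul (continuousAt_const.div (by fun_prop) (by simpa using hq)))
  have H := continuousAt_id.mul (((c1.mul c2).mul_const (eulerJ 1 q)).inv₀
    (by simp [hJ, hJ1, div_self hq]))
  have H' : Tendsto (fun z => z * (qPochInf (-z) q * qPochInf (q * (q / -z)) q * eulerJ 1 q)⁻¹)
      (𝓝[≠] (-q)) (𝓝 (-q * (qPochInf (-(-q)) q * qPochInf (q * (q / -(-q))) q * eulerJ 1 q)⁻¹)) :=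
    H.tendsto.mono_left nhdsWithin_le_nhds
  simp only [neg_neg, div_self hq, mul_one, hJ] at H'
  rw [div_eq_mul_inv, pow_three']
  refine H'.congr' ?_
  filter_upwards [self_mem_nhdsWithin, nhdsWithin_le_nhds (isOpen_ne.mem_nhds hnq)] with z hz hz0
  have hz' : z + q ≠ 0 := fun e => hz (by simp; linear_combination e)
  rw [thetaJ, qPochInf_eq_mul hq1 (q / -z), hJ, sub_neg_eq_add,
    show 1 - q / -z = (z + q) / z by field_simp; ring]
  rw [show ∀ A B C : ℂ, A * ((z + q) / z * B) * C = (z + q) * (A * B * C / z) from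
    fun A B C => by ring, div_mul_eq_div_div, div_self hz', one_div, inv_div]
  exact (div_eq_mul_inv _ _).symm

/-- Matches the last two residues of the Appell–Lerch side: they are equal at -1 and opposite at -q.
-/
theorem one_div_thetaJBar_mul_one_div_thetaJ {q : ℂ} (hq : q ≠ 0) (hq1 : ‖q‖ < 1) :
    1 / thetaJBar 1 4 q * (1 / thetaJ (-1) q) =
      1 / 2 * (eulerJ 1 q ^ 5 / eulerJ 2 q ^ 4) * (1 / eulerJ 1 q ^ 3) := by
  have hJ1 : eulerJ 1 q ≠ 0 := eulerJ_ne_zero hq1 one_ne_zero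
  have hJ2 : eulerJ 2 q ≠ 0 := eulerJ_ne_zero hq1 two_ne_zero
  rw [eq_div_of_mul_eq hJ1 (thetaJBar_mul hq hq1), eq_div_of_mul_eq hJ1 (thetaJ_neg_one_mul hq1)]
  field_simp

theorem two_div_thetaJ_neg_one_sq {q : ℂ} (hq : q ≠ 0) (hq1 : ‖q‖ < 1) :
    2 / thetaJ (-1) (q ^ 2) =
      2 * thetaJ (-q) (q ^ 2) * (1 / thetaJBar 1 4 q * (1 / thetaJ (-1) q)) := by
  have hJ1 : eulerJ 1 q ≠ 0 := eulerJ_ne_zero hq1 one_ne_zero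
  have hJ2 : eulerJ 2 q ≠ 0 := eulerJ_ne_zero hq1 two_ne_zero
  have hJ4 : eulerJ 4 q ≠ 0 := eulerJ_ne_zero hq1 four_ne_zero
  have h := thetaJ_neg_one_mul (norm_sq_lt_one hq1)
  rw [← eulerJ_two_eq, ← eulerJ_four_eq] at h
  rw [eq_div_of_mul_eq hJ1 (thetaJBar_mul hq hq1), eq_div_of_mul_eq hJ1 (thetaJ_neg_one_mul hq1),
    eq_div_of_mul_eq (pow_ne_zero 2 (mul_ne_zero hJ1 hJ4)) (thetaJ_neg_self_sq_mul hq hq1),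
    eq_div_of_mul_eq hJ2 h]
  field_simp

theorem tendsto_mul_appellLerchSide {q c A B T : ℂ} (hq : q ≠ 0) (hq1 : ‖q‖ < 1) (hc : c ≠ 0)
    (hA : Tendsto (fun z => (z - c) * appellLerch z (q ^ 2) (-1)) (𝓝[≠] c) (𝓝 A))
    (hB : Tendsto (fun z => (z - c) * appellLerch z q (-1)) (𝓝[≠] c) (𝓝 B))
    (hT : Tendsto (fun z => (z - c) / thetaJ (-z) q) (𝓝[≠] c) (𝓝 T)) :
    Tendsto (fun z => (z - c) * appellLerchSide q z) (𝓝[≠] c)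
      (𝓝 (2 * A - thetaJ (c * q) (q ^ 2) / thetaJBar 1 4 q * B
        - 1 / 2 * (eulerJ 1 q ^ 5 / eulerJ 2 q ^ 4) * (thetaJ (c * q) (q ^ 2) * T))) := by
  have hθ := (differentiableAt_thetaJ_mul hq hq1 hc).continuousAt.tendsto.mono_left
    (nhdsWithin_le_nhds (s := {c}ᶜ))
  refine (((hA.const_mul 2).sub ((hθ.div_const _).mul hB)).sub
    ((hθ.mul hT).const_mul _)).congr fun z => ?_
  rw [appellLerchSide]
  ring

/-! ### Comparison of the two sides -/

theorem tsum_eulerianTerm_eq {q a : ℂ} (hq : q ≠ 0) (hq1 : ‖q‖ < 1) (ha : a ≠ 0)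
    (hgen : ∀ k : ℤ, a ≠ -q ^ k) :
    (1 + 1 / a) * ∑' n, eulerianTerm q a n = appellLerchSide q a := by
  have hq2 : q ^ 2 ≠ 0 := pow_ne_zero 2 hq
  have hq21 := norm_sq_lt_one hq1
  set F : ℂ → ℂ := fun a => (1 + 1 / a) * ∑' n, eulerianTerm q a n with hF
  have hFd : ∀ z ≠ 0, DifferentiableAt ℂ F z := fun z hz =>
    (((differentiableAt_const 1).div differentiableAt_id hz).const_add 1).mul
      (differentiableAt_tsum_eulerianTerm hq1 hz)
  have hF0 : ∀ c ≠ 0, Tendsto (fun z => (z - c) * F z) (𝓝[≠] c) (𝓝 0) := fun c hc => by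
    have hid : ContinuousAt (fun z => (z - c) * F z) c :=
      (by fun_prop : ContinuousAt (fun z => z - c) c).mul (hFd c hc).continuousAt
    have := hid.tendsto.mono_left (nhdsWithin_le_nhds (s := {c}ᶜ))
    simpa using this
  have hK := one_div_thetaJBar_mul_one_div_thetaJ hq hq1
  -- At -1 all three terms have residues; the last two are equal and together cancel 2/j(-1;q²).
  have r0 : Tendsto (fun z => (z - (-1)) * appellLerchSide q z) (𝓝[≠] (-1)) (𝓝 0) := by
    have hA := tendsto_mul_appellLerch_neg_one hq2 hq21 0
    have hB := tendsto_mul_appellLerch_neg_one hq hq1 0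
    simp only [zpow_zero, triWeight, zero_mul, EuclideanDomain.zero_div] at hA hB
    convert tendsto_mul_appellLerchSide hq hq1 (by norm_num) hA hB
      (tendsto_add_one_div_thetaJ_neg hq1) using 2
    have := two_div_thetaJ_neg_one_sq hq hq1
    rw [neg_one_mul]
    linear_combination -this - thetaJ (-q) (q ^ 2) * hK
  have r1 : Tendsto (fun z => (z - (-q)) * appellLerchSide q z) (𝓝[≠] (-q)) (𝓝 0) := by
    -- The poles of m(a,q²,-1) are the -q^(2k), so -q is not among them and the other two terms must
    -- cancel.
    have hA : Tendsto (fun z => (z - (-q)) * appellLerch z (q ^ 2) (-1)) (𝓝[≠] (-q)) (𝓝 0) := by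
      have hd := differentiableAt_appellLerch_neg_one hq2 hq21 (neg_ne_zero.mpr hq) fun k hk => by
        have h1 : q ^ (1 : ℤ) = q ^ (2 * k) := by
          rw [zpow_one, zpow_mul, zpow_ofNat]; exact neg_injective hk
        have := zpow_injective_of_norm_lt_one hq hq1 h1
        omega
      have hid : ContinuousAt (fun z => (z - (-q)) * appellLerch z (q ^ 2) (-1)) (-q) :=
        (by fun_prop : ContinuousAt (fun z => z - (-q)) (-q)).mul hd.continuousAt
      have := hid.tendsto.mono_left (nhdsWithin_le_nhds (s := {-q}ᶜ))
      simpa using this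
    have hB := tendsto_mul_appellLerch_neg_one hq hq1 1
    have h1 : triWeight q 1 = q := by norm_num [triWeight]
    rw [zpow_one, h1] at hB
    convert tendsto_mul_appellLerchSide hq hq1 (neg_ne_zero.mpr hq) hA hB
      (tendsto_add_self_div_thetaJ_neg hq hq1) using 2
    linear_combination q * thetaJ (-q * q) (q ^ 2) * hK
  have hres : ∀ c ≠ 0, Tendsto (fun z => (z - c) * appellLerchSide q z) (𝓝[≠] c) (𝓝 0) →
      Tendsto (fun z => (z - c) * (F z - appellLerchSide q z)) (𝓝[≠] c) (𝓝 0) := fun c hc h => by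
    have := (hF0 c hc).sub h
    rw [sub_zero] at this
    exact this.congr fun z => (mul_sub _ _ _).symm
  have hD := eq_zero_of_quasiperiodic_of_residues (f := fun z => F z - appellLerchSide q z) hq hq1
    (fun z hz hzg => (hFd z hz).sub (differentiableAt_appellLerchSide hq hq1 hz hzg))
    (fun z hz hzg => by
      have h1 := eulerianTerm_quasiperiodic hq hq1 hz
      have h2 := appellLerchSide_quasiperiodic hq hq1 hz hzg
      simp only [hF]
      linear_combination h1 - h2)
    (hres _ (by norm_num) r0) (hres _ (neg_ne_zero.mpr hq) r1) ha hgen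
  exact sub_eq_zero.mp hD

theorem mainTheorem6 (q a : ℂ) (hq : q ≠ 0) (hq1 : ‖q‖ < 1) (ha : a ≠ 0)
    (hgen : ∀ k : ℤ, a ≠ -q ^ k) :
    Summable (fun n : ℕ =>
      qPoch (a * q) (q ^ 2) n * qPoch (q / a) (q ^ 2) n * q ^ (2 * n + 1) /
        qPoch (-q) q (2 * n + 1)) ∧
    (1 + 1 / a) * ∑' n : ℕ,
      qPoch (a * q) (q ^ 2) n * qPoch (q / a) (q ^ 2) n * q ^ (2 * n + 1) /
        qPoch (-q) q (2 * n + 1) =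
      2 * appellLerch a (q ^ 2) (-1)
        - thetaJ (a * q) (q ^ 2) / thetaJBar 1 4 q * appellLerch a q (-1)
        - 1 / 2 * (eulerJ 1 q ^ 5 / eulerJ 2 q ^ 4)
          * (thetaJ (a * q) (q ^ 2) / thetaJ (-a) q) :=
  ⟨summable_eulerianTerm hq1 ha, tsum_eulerianTerm_eq hq hq1 ha hgen⟩
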